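/- **Conventions.** $U\subset\mathbb R^2$ is open with coordinates $(u,v)$; smooth means $C^\infty$; subscripts $u,v$ denote partial derivatives; $D$ is the Jacobian matrix; $\Lambda_{(i)}$ is the $i$-th row of a $2\times 2$ matrix $\Lambda$ (and $\Lambda_{(i)u},\Lambda_{(i)v}$ its partial derivatives). A smooth map $\mathbf x:V\to\mathbb R^3$ on an open $V\subset\mathbb R^2$ is a *frontal* if every point of $V$ has an open neighbourhood in $V$ that carries a smooth unit vector field orthogonal to $\mathbf x_u$ and $\mathbf x_v$. A *tangent moving base* of $\mathbf x$ is a smooth map $\mathbf\Omega=(\mathbf w_1\ \mathbf w_2):V\to M_{3\times 2}(\mathbb R)$ with linearly independent columns such that $\mathbf x_u,\mathbf x_v\in\operatorname{span}(\mathbf w_1,\mathbf w_2)$ at every point. Put $\mathbf n=\frac{\mathbf w_1\times\mathbf w_2}{\|\mathbf w_1\times\mathbf w_2\|}$, $\mathbf I_\Omega=\mathbf\Omega^T\mathbf\Omega$ and $\mathbf{II}_\Omega=-\mathbf\Omega^TD\mathbf n$. The coefficients of the first and second fundamental forms of $\mathbf x$ (the second one with respect to the normal $\mathbf n$ induced by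 $\mathbf\Omega$) are $\mathbf x_u\cdot\mathbf x_u,\ \mathbf x_u\cdot\mathbf x_v,\ \mathbf x_v\cdot\mathbf x_v$ and $\mathbf n\cdot\mathbf x_{uu},\ \mathbf n\cdot\mathbf x_{uv},\ \mathbf n\cdot\mathbf x_{vv}$. Given functions $E,F,G$ with $EG-F^2\ne0$, the Christoffel symbols are defined by $$\begin{pmatrix}\Gamma_{11}^1&\Gamma_{11}^2\\ \Gamma_{21}^1&\Gamma_{21}^2\end{pmatrix}=\begin{pmatrix}\frac12E_u&F_u-\frac12E_v\\ \frac12E_v&\frac12G_u\end{pmatrix}\begin{pmatrix}E&F\\F&G\end{pmatrix}^{-1},\qquad \begin{pmatrix}\Gamma_{12}^1&\Gamma_{12}^2\\ \Gamma_{22}^1&\Gamma_{22}^2\end{pmatrix}=\begin{pmatrix}\frac12E_v&\frac12G_u\\ F_v-\frac12G_u&\frac12G_v\end{pmatrix}\begin{pmatrix}E&F\\F&G\end{pmatrix}^{-1}.$$ With $K=\frac{eg-f^2}{EG-F^2}$, the Gauss equation is $$(\Gamma_{12}^2)_u-(\Gamma_{11}^2)_v+\Gamma_{12}^1\Gamma_{11}^2+\Gamma_{12}^2\Gamma_{12}^2-\Gamma_{11}^2\Gamma_{22}^2-\Gamma_{11}^1\Gamma_{12}^2=-EK,$$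 and the Mainardi–Codazzi equations are $$e_v-f_u=e\,\Gamma_{12}^1+f(\Gamma_{12}^2-\Gamma_{11}^1)-g\,\Gamma_{11}^2,\qquad f_v-g_u=e\,\Gamma_{22}^1+f(\Gamma_{22}^2-\Gamma_{12}^1)-g\,\Gamma_{12}^2.$$ **Theorem (The Fundamental Theorem).** Let $E,F,G,e,f,g$ be smooth real functions on the open set $U\subset\mathbb R^2$ with $E\ge0$, $G\ge0$, $EG-F^2\ge0$. Assume that $$\begin{pmatrix}E&F\\F&G\end{pmatrix}=\Lambda\begin{pmatrix}E_\Omega&F_\Omega\\F_\Omega&G_\Omega\end{pmatrix}\Lambda^T,\qquad \begin{pmatrix}e&f\\f&g\end{pmatrix}=\Lambda\begin{pmatrix}e_\Omega&f_{1\Omega}\\f_{2\Omega}&g_\Omega\end{pmatrix},\qquad \Lambda=(\lambda_{ij})_{i,j\in\{1,2\}},$$ on $U$, where all entries are smooth real functions on $U$, $E_\Omega>0$, $G_\Omega>0$, $E_\Omega G_\Omega-F_\Omega^2>0$, and the zero set $\lambda_\Omega^{-1}(0)\subset U$ of $\lambda_\Omega=\det\Lambda$ has empty interior. Assume further that, with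 $A=\begin{pmatrix}E_\Omega&F_\Omega\\F_\Omega&G_\Omega\end{pmatrix}$, the two functions $$\Lambda_{(1)u}A\Lambda_{(2)}^T-\Lambda_{(1)}A\Lambda_{(2)u}^T+E_v-F_u\quad\text{and}\quad \Lambda_{(1)v}A\Lambda_{(2)}^T-\Lambda_{(1)}A\Lambda_{(2)v}^T+F_v-G_u$$ belong to the principal ideal generated by $\lambda_\Omega$ in the ring $C^\infty(U,\mathbb R)$, and that $E,F,G,e,f,g$ satisfy the Gauss and Mainardi–Codazzi equations at every point of $U\setminus\lambda_\Omega^{-1}(0)$. 1. For each $(u_0,v_0)\in U$ there are an open neighbourhood $V\subset U$ of $(u_0,v_0)$ and a frontal $\mathbf x:V\to\mathbb R^3$ with a tangent moving base $\mathbf\Omega:V\to M_{3\times2}(\mathbb R)$ such that, on $V$, $$D\mathbf x=\mathbf\Omega\Lambda^T,\qquad \mathbf I_\Omega=\begin{pmatrix}E_\Omega&F_\Omega\\F_\Omega&G_\Omega\end{pmatrix},\qquad \mathbf{II}_\Omega=\begin{pmatrix}e_\Omega&f_{1\Omega}\\f_{2\Omega}&g_\Omega\end{pmatrix},$$ and $\mathbf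 x$ has $E,F,G$ and $e,f,g$ as the coefficients of its first and second fundamental forms, respectively. 2. If $U$ is connected and $(\mathbf x,\mathbf\Omega)$, $(\bar{\mathbf x},\bar{\mathbf\Omega})$ are two pairs, each consisting of a frontal $U\to\mathbb R^3$ and a tangent moving base $U\to M_{3\times2}(\mathbb R)$ of it, which both satisfy all the conditions of part 1 on $V=U$, then there are a rotation $\boldsymbol\rho\in SO(3)$ and a vector $\mathbf a\in\mathbb R^3$ with $\bar{\mathbf\Omega}=\boldsymbol\rho\,\mathbf\Omega$ and $\bar{\mathbf x}=\boldsymbol\rho\,\mathbf x+\mathbf a$ on $U$. -/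

import Mathlib

open scoped ContDiff Matrix

noncomputable section

namespace Frontals

/-- The partial derivative `∂f/∂u` of a function of `(u, v) ∈ ℝ²`. -/
def du (f : ℝ × ℝ → ℝ) (p : ℝ × ℝ) : ℝ := fderiv ℝ f p (1, 0)

/-- The partial derivative `∂f/∂v` of a function of `(u, v) ∈ ℝ²`. -/
def dv (f : ℝ × ℝ → ℝ) (p : ℝ × ℝ) : ℝ := fderiv ℝ f p (0, 1)

/-- The partial derivative in `u` of a vector-valued map, taken componentwise. -/
def vecDu {n : ℕ} (x : ℝ × ℝ → Fin n → ℝ) (p : ℝ × ℝ) : Fin n → ℝ :=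
  fun i => du (fun q => x q i) p

/-- The partial derivative in `v` of a vector-valued map, taken componentwise. -/
def vecDv {n : ℕ} (x : ℝ × ℝ → Fin n → ℝ) (p : ℝ × ℝ) : Fin n → ℝ :=
  fun i => dv (fun q => x q i) p

/-- The Jacobian matrix `Dx`, whose two columns are `x_u` and `x_v`. -/
def jacobian {n : ℕ} (x : ℝ × ℝ → Fin n → ℝ) (p : ℝ × ℝ) : Matrix (Fin n) (Fin 2) ℝ :=
  Matrix.of fun i j => ![vecDu x p i, vecDv x p i] j

/-- The partial derivative in `u` of a matrix-valued map, taken entrywise. -/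
def matDu {m n : ℕ} (A : ℝ × ℝ → Matrix (Fin m) (Fin n) ℝ) (p : ℝ × ℝ) :
    Matrix (Fin m) (Fin n) ℝ :=
  Matrix.of fun i j => du (fun q => A q i j) p

/-- The partial derivative in `v` of a matrix-valued map, taken entrywise. -/
def matDv {m n : ℕ} (A : ℝ × ℝ → Matrix (Fin m) (Fin n) ℝ) (p : ℝ × ℝ) :
    Matrix (Fin m) (Fin n) ℝ :=
  Matrix.of fun i j => dv (fun q => A q i j) p

/-- A real function is smooth on the (open) set `U`. -/
def SmoothOn (U : Set (ℝ × ℝ)) (f : ℝ × ℝ → ℝ) : Prop := ContDiffOn ℝ ∞ f U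

/-- A vector-valued map is smooth on `U`: all components are. -/
def VecSmoothOn {n : ℕ} (U : Set (ℝ × ℝ)) (x : ℝ × ℝ → Fin n → ℝ) : Prop :=
  ∀ i, SmoothOn U fun p => x p i

/-- A matrix-valued map is smooth on `U`: all entries are. -/
def MatSmoothOn {m n : ℕ} (U : Set (ℝ × ℝ)) (A : ℝ × ℝ → Matrix (Fin m) (Fin n) ℝ) : Prop :=
  ∀ i j, SmoothOn U fun p => A p i j

/-- The restriction of `h` to `U` lies in the principal ideal of the ring `C^∞(U, ℝ)` generated by
the restriction of `l`: it is the product of `l` and an element of that ring. -/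
def MemPrincipalIdeal (U : Set (ℝ × ℝ)) (l h : ℝ × ℝ → ℝ) : Prop :=
  ∃ t : ℝ × ℝ → ℝ, SmoothOn U t ∧ ∀ p ∈ U, h p = l p * t p

/-- The symmetric matrix `(a b; b c)`. -/
def symMat (a b c : ℝ × ℝ → ℝ) (p : ℝ × ℝ) : Matrix (Fin 2) (Fin 2) ℝ :=
  !![a p, b p; b p, c p]

/-! ### Christoffel symbols and the classical integrability equations -/

/-- The matrix `Γ₁`. Its entry in row `i`, column `j` is the Christoffel symbol with lower indices
`i, 1` and upper index `j`. -/
def christoffel₁ (E F G : ℝ × ℝ → ℝ) (p : ℝ × ℝ) : Matrix (Fin 2) (Fin 2) ℝ :=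
  !![du E p / 2, du F p - dv E p / 2; dv E p / 2, du G p / 2] * (symMat E F G p)⁻¹

/-- The matrix `Γ₂`. Its entry in row `i`, column `j` is the Christoffel symbol with lower indices
`i, 2` and upper index `j`. -/
def christoffel₂ (E F G : ℝ × ℝ → ℝ) (p : ℝ × ℝ) : Matrix (Fin 2) (Fin 2) ℝ :=
  !![dv E p / 2, du G p / 2; dv F p - du G p / 2, dv G p / 2] * (symMat E F G p)⁻¹

/-- The Gaussian curvature `(eg - f²) / (EG - F²)` formed from the six coefficients. -/
def gaussCurvature (E F G e f g : ℝ × ℝ → ℝ) (p : ℝ × ℝ) : ℝ :=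
  (e p * g p - f p ^ 2) / (E p * G p - F p ^ 2)

/-- The Gauss equation at `p` (meaningful where `EG - F² ≠ 0`):
`(Γ_12^2)_u - (Γ_11^2)_v + Γ_12^1 Γ_11^2 + Γ_12^2 Γ_12^2 - Γ_11^2 Γ_22^2 - Γ_11^1 Γ_12^2 = -E K`. -/
def GaussEq (E F G e f g : ℝ × ℝ → ℝ) (p : ℝ × ℝ) : Prop :=
  du (fun q => christoffel₂ E F G q 0 1) p - dv (fun q => christoffel₁ E F G q 0 1) p
      + christoffel₂ E F G p 0 0 * christoffel₁ E F G p 0 1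
      + christoffel₂ E F G p 0 1 * christoffel₂ E F G p 0 1
      - christoffel₁ E F G p 0 1 * christoffel₂ E F G p 1 1
      - christoffel₁ E F G p 0 0 * christoffel₂ E F G p 0 1
    = -(E p * gaussCurvature E F G e f g p)

/-- The two Mainardi–Codazzi equations at `p`:
`e_v - f_u = e Γ_12^1 + f (Γ_12^2 - Γ_11^1) - g Γ_11^2` and
`f_v - g_u = e Γ_22^1 + f (Γ_22^2 - Γ_12^1) - g Γ_12^2`. -/
def MainardiCodazziEq (E F G e f g : ℝ × ℝ → ℝ) (p : ℝ × ℝ) : Prop :=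
  (dv e p - du f p = e p * christoffel₂ E F G p 0 0
      + f p * (christoffel₂ E F G p 0 1 - christoffel₁ E F G p 0 0)
      - g p * christoffel₁ E F G p 0 1) ∧
  (dv f p - du g p = e p * christoffel₂ E F G p 1 0
      + f p * (christoffel₂ E F G p 1 1 - christoffel₂ E F G p 0 0)
      - g p * christoffel₂ E F G p 0 1)

/-! ### Frontals and moving bases -/

/-- `x` is a frontal on the open set `V`: it is smooth and locally admits a smooth unit vector field
that is orthogonal to both partial derivatives of `x`. -/
def IsFrontal (V : Set (ℝ × ℝ)) (x : ℝ × ℝ → Fin 3 → ℝ) : Prop :=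
  VecSmoothOn V x ∧
    ∀ p ∈ V, ∃ W : Set (ℝ × ℝ), IsOpen W ∧ p ∈ W ∧ W ⊆ V ∧
      ∃ ν : ℝ × ℝ → Fin 3 → ℝ, VecSmoothOn W ν ∧
        ∀ q ∈ W, ν q ⬝ᵥ ν q = 1 ∧ ν q ⬝ᵥ vecDu x q = 0 ∧ ν q ⬝ᵥ vecDv x q = 0

/-- `Ω` is a moving base on `V`: smooth, with linearly independent columns. -/
def IsMovingBase (V : Set (ℝ × ℝ)) (Ω : ℝ × ℝ → Matrix (Fin 3) (Fin 2) ℝ) : Prop :=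
  MatSmoothOn V Ω ∧ ∀ p ∈ V, LinearIndependent ℝ (Ω p).col

/-- `Ω` is a tangent moving base of `x` on `V`: a moving base whose columns span a plane that
contains `x_u` and `x_v`. -/
def IsTangentMovingBase (V : Set (ℝ × ℝ)) (x : ℝ × ℝ → Fin 3 → ℝ)
    (Ω : ℝ × ℝ → Matrix (Fin 3) (Fin 2) ℝ) : Prop :=
  IsMovingBase V Ω ∧ ∀ p ∈ V,
    vecDu x p ∈ Submodule.span ℝ (Set.range (Ω p).col) ∧
    vecDv x p ∈ Submodule.span ℝ (Set.range (Ω p).col)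

/-- The cross product `w₁ × w₂` of the columns of `Ω`. -/
def crossCols (Ω : ℝ × ℝ → Matrix (Fin 3) (Fin 2) ℝ) (p : ℝ × ℝ) : Fin 3 → ℝ :=
  crossProduct ((Ω p).col 0) ((Ω p).col 1)

/-- The unit normal `n = (w₁ × w₂) / ‖w₁ × w₂‖` (Euclidean norm) induced by a moving base. -/
def unitNormal (Ω : ℝ × ℝ → Matrix (Fin 3) (Fin 2) ℝ) (p : ℝ × ℝ) : Fin 3 → ℝ :=
  (Real.sqrt (crossCols Ω p ⬝ᵥ crossCols Ω p))⁻¹ • crossCols Ω p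

/-- The matrix `I_Ω = Ωᵀ Ω` of a moving base. -/
def baseFirstForm (Ω : ℝ × ℝ → Matrix (Fin 3) (Fin 2) ℝ) (p : ℝ × ℝ) :
    Matrix (Fin 2) (Fin 2) ℝ :=
  (Ω p)ᵀ * Ω p

/-- The matrix `II_Ω = -Ωᵀ Dn` of a moving base. -/
def baseSecondForm (Ω : ℝ × ℝ → Matrix (Fin 3) (Fin 2) ℝ) (p : ℝ × ℝ) :
    Matrix (Fin 2) (Fin 2) ℝ :=
  -((Ω p)ᵀ * jacobian (unitNormal Ω) p)

/-- The matrix `I` of the first fundamental form of `x`. -/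
def firstForm (x : ℝ × ℝ → Fin 3 → ℝ) (p : ℝ × ℝ) : Matrix (Fin 2) (Fin 2) ℝ :=
  !![vecDu x p ⬝ᵥ vecDu x p, vecDu x p ⬝ᵥ vecDv x p;
     vecDu x p ⬝ᵥ vecDv x p, vecDv x p ⬝ᵥ vecDv x p]

/-- The matrix `II` of the second fundamental form of `x` with respect to a normal field `ν`. -/
def secondForm (x ν : ℝ × ℝ → Fin 3 → ℝ) (p : ℝ × ℝ) : Matrix (Fin 2) (Fin 2) ℝ :=
  !![ν p ⬝ᵥ vecDu (vecDu x) p, ν p ⬝ᵥ vecDv (vecDu x) p;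
     ν p ⬝ᵥ vecDv (vecDu x) p, ν p ⬝ᵥ vecDv (vecDv x) p]

/-- On `V`, the map `x` is a frontal with tangent moving base `Ω` such that `Dx = Ω Λᵀ`, the base has
`I_Ω = A` and `II_Ω = B`, and `x` has the fundamental forms `I = M` and `II = N`; the second
fundamental form of `x` is taken with the unit normal induced by `Ω`. -/
structure Realizes (V : Set (ℝ × ℝ)) (Λ A B M N : ℝ × ℝ → Matrix (Fin 2) (Fin 2) ℝ)
    (x : ℝ × ℝ → Fin 3 → ℝ) (Ω : ℝ × ℝ → Matrix (Fin 3) (Fin 2) ℝ) : Prop where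
  frontal : IsFrontal V x
  tangent : IsTangentMovingBase V x Ω
  differential : ∀ p ∈ V, jacobian x p = Ω p * (Λ p)ᵀ
  base_first : ∀ p ∈ V, baseFirstForm Ω p = A p
  base_second : ∀ p ∈ V, baseSecondForm Ω p = B p
  first : ∀ p ∈ V, firstForm x p = M p
  second : ∀ p ∈ V, secondForm x (unitNormal Ω) p = N p

end Frontals

end

/-!
The unknowns are a frame `W = (w₁ w₂ n)`, formed by the moving base and its unit normal, and the map
`x`. Prescribing `I_Ω = A` and `II_Ω = B` fixes the Gram matrix of `W`, and fixes `Wᵀ W_u` and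
`Wᵀ W_v` up to one function each: `aU = (⟪w₂, ∂_u w₁⟫ - ⟪w₁, ∂_u w₂⟫) / 2` and its analogue `aV`
for `v`. The equation `(x_u)_v = (x_v)_u` for `Dx = Ω Λᵀ` forces `2 λ_Ω aU` and `2 λ_Ω aV` to be the
negatives of the two functions in the ideal hypotheses. So these hypotheses say exactly that the
connection matrices `P = W⁻¹ W_u` and `Q = W⁻¹ W_v` extend smoothly across the singular set, and the
density of the regular set makes the extension unique.

Where `λ_Ω ≠ 0`, the change of frame `diag(Λᵀ, 1)` turns `(P, Q)` into the connection of the frame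
`(x_u x_v n)`, given by the Christoffel symbols of `E, F, G` (`frameChange_mul_conn`). Three entries
of the curvature of that connection are the Gauss and Mainardi–Codazzi equations, and the others
follow because the curvature of a metric connection is skew
(`curvature_classicalConn_eq_zero`). Curvature is conjugated by a change of frame, so `(P, Q)` is
flat on the regular set, and by density everywhere (`CompatibleData.curvature_eq_zero`).

Existence then comes from the Frobenius theorem for linear systems `W_u = W P`, `W_v = W Q`
(`exists_solution_of_flat`), which is proved by solving along `u` and then along `v`, with Grönwall's
inequality for the differentiability in `u`; smoothness is a bootstrap. If `W` and `W'` are two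
frames with the same connection and `H` is the prescribed Gram matrix, then `W' H⁻¹ Wᵀ` is constant
(`matD_mul_inv_mul_transpose`). With `W' = W` this shows that the solution keeps the Gram matrix `H`
of its initial value; for the frames of two realizations it is the rotation `ρ` of the uniqueness
statement. Finally `x` is a primitive of the closed `1`-form `Ω Λᵀ`.
-/

noncomputable section

namespace Frontals

open Set Metric Filter Topology Asymptotics

/-! ### Linear total differential systems -/

/-- A short-time form of Grönwall's inequality, valid on both sides of `t₀`: if `Cε ≤ 1/2`, then a
differential inequality `‖f'‖ ≤ C‖f‖ + κ` on `[t₀ - ε, t₀ + ε]` bounds `f` by its initial value. -/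
theorem norm_le_of_norm_deriv_le {X : Type*} [NormedAddCommGroup X] [NormedSpace ℝ X]
    {f f' : ℝ → X} {t₀ ε C κ : ℝ} (hC : 0 ≤ C) (hCε : C * ε ≤ 1 / 2)
    (hf : ∀ t ∈ Icc (t₀ - ε) (t₀ + ε), HasDerivWithinAt f (f' t) (Icc (t₀ - ε) (t₀ + ε)) t)
    (hb : ∀ t ∈ Icc (t₀ - ε) (t₀ + ε), ‖f' t‖ ≤ C * ‖f t‖ + κ) {t : ℝ}
    (ht : t ∈ Icc (t₀ - ε) (t₀ + ε)) : ‖f t‖ ≤ 2 * (‖f t₀‖ + ε * κ) := by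
  have h0 : t₀ ∈ Icc (t₀ - ε) (t₀ + ε) := by
    constructor <;> linarith [ht.1.trans ht.2]
  have hcont : ContinuousOn (fun t => ‖f t‖) (Icc (t₀ - ε) (t₀ + ε)) :=
    fun t ht => (hf t ht).continuousWithinAt.norm
  obtain ⟨m, hm, hmax⟩ := isCompact_Icc.exists_isMaxOn ⟨t, ht⟩ hcont
  have hmax' : ∀ s ∈ Icc (t₀ - ε) (t₀ + ε), ‖f s‖ ≤ ‖f m‖ := fun s hs => hmax hs
  have hS : ∀ s ∈ Icc (t₀ - ε) (t₀ + ε), ‖f' s‖ ≤ C * ‖f m‖ + κ := fun s hs =>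
    (hb s hs).trans (by gcongr; exact hmax' s hs)
  have h1 := (convex_Icc (t₀ - ε) (t₀ + ε)).norm_image_sub_le_of_norm_hasDerivWithin_le hf hS h0 hm
  have h2 : ‖m - t₀‖ ≤ ε := by
    rw [Real.norm_eq_abs, abs_le]; constructor <;> linarith [hm.1, hm.2]
  have h3 : (C * ‖f m‖ + κ) * ‖m - t₀‖ ≤ (C * ‖f m‖ + κ) * ε :=
    mul_le_mul_of_nonneg_left h2 ((norm_nonneg _).trans (hS m hm))
  have h4 : ‖f m‖ ≤ ‖f t₀‖ + ‖f m - f t₀‖ := by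
    simpa using norm_add_le (f t₀) (f m - f t₀)
  have h5 : C * ε * ‖f m‖ ≤ 1 / 2 * ‖f m‖ := by gcongr
  linarith [hmax' t ht]

section BanachAlgebra

variable {R : Type*} [NormedRing R] [NormedAlgebra ℝ R]

/-- Linear equations are solvable for a time that does not depend on the initial value, so the
solutions over all nearby vertical lines live on a common rectangle. -/
theorem exists_linear_ode [CompleteSpace R] {A : ℝ → R} {t₀ ε C : ℝ} (hε : 0 ≤ ε) (hC : 0 ≤ C)
    (hCε : C * ε ≤ 1 / 2) (hA : ContinuousOn A (Icc (t₀ - ε) (t₀ + ε)))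
    (hb : ∀ t ∈ Icc (t₀ - ε) (t₀ + ε), ‖A t‖ ≤ C) (y₀ : R) :
    ∃ y : ℝ → R, y t₀ = y₀ ∧ ∀ t ∈ Icc (t₀ - ε) (t₀ + ε),
      HasDerivWithinAt y (y t * A t) (Icc (t₀ - ε) (t₀ + ε)) t := by
  lift C to NNReal using hC
  have h0 : t₀ ∈ Icc (t₀ - ε) (t₀ + ε) := by constructor <;> linarith
  -- on the ball of radius `‖y₀‖ + 1` the field is bounded by `C (2 ‖y₀‖ + 1)`
  have hPL : IsPicardLindelof (fun t y => y * A t) (⟨t₀, h0⟩ : Icc (t₀ - ε) (t₀ + ε)) y₀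
      (‖y₀‖₊ + 1) 0 (C * (2 * ‖y₀‖₊ + 1)) C := by
    refine ⟨fun t ht => ?_, fun x _ => continuousOn_const.mul hA, fun t ht x hx => ?_, ?_⟩
    · refine LipschitzOnWith.of_dist_le_mul fun x _ y _ => ?_
      rw [dist_eq_norm, dist_eq_norm, ← sub_mul, mul_comm (C : ℝ)]
      exact (norm_mul_le _ _).trans (by gcongr; exact hb t ht)
    · have hx' : ‖x‖ ≤ 2 * ‖y₀‖ + 1 := by
        have h1 : ‖x - y₀‖ ≤ ‖y₀‖ + 1 := by simpa [dist_eq_norm] using hx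
        have h2 : ‖x‖ ≤ ‖y₀‖ + ‖x - y₀‖ := by simpa using norm_add_le y₀ (x - y₀)
        linarith
      calc ‖x * A t‖ ≤ ‖x‖ * ‖A t‖ := norm_mul_le _ _
        _ ≤ (2 * ‖y₀‖ + 1) * C := by gcongr; exact hb t ht
        _ = _ := by push_cast; ring
    · have : max (t₀ + ε - t₀) (t₀ - (t₀ - ε)) = ε := by
        rw [show t₀ + ε - t₀ = ε by ring, show t₀ - (t₀ - ε) = ε by ring, max_self]
      simp only [this]
      push_cast
      have := norm_nonneg y₀
      nlinarith
  obtain ⟨y, hy0, hy⟩ := hPL.exists_eq_forall_mem_Icc_hasDerivWithinAt₀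
  exact ⟨y, hy0, hy⟩

/-- The differentiation step of the construction of solutions of total systems: let `ψ s` solve
`y_v = y Q` on the vertical line over `s`, with initial values `φ s` that solve `y_u = y P` on the
horizontal line at height `v₀`. Flatness makes `ψ u + (s - u) ψ u P` an approximate solution over
`s`, with an error quadratic in `s - u`, so `ψ` solves `y_u = y P` at every height. -/
theorem hasDerivAt_of_flat {P Q : ℝ × ℝ → R} {u₀ v₀ ε C : ℝ} (hC : 0 ≤ C)
    (hCε : C * ε ≤ 1 / 2)
    (hP : ∀ p ∈ closedBall (u₀, v₀) ε, DifferentiableAt ℝ P p)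
    (hQ : ∀ p ∈ closedBall (u₀, v₀) ε, DifferentiableAt ℝ Q p)
    (hQu : ∀ p ∈ closedBall (u₀, v₀) ε, DifferentiableAt ℝ (fun q => fderiv ℝ Q q (1, 0)) p)
    (bP : ∀ p ∈ closedBall (u₀, v₀) ε, ‖P p‖ ≤ C)
    (bQ : ∀ p ∈ closedBall (u₀, v₀) ε, ‖Q p‖ ≤ C)
    (bdQ : ∀ p ∈ closedBall (u₀, v₀) ε, ‖fderiv ℝ Q p‖ ≤ C)
    (bdQu : ∀ p ∈ closedBall (u₀, v₀) ε, ‖fderiv ℝ (fun q => fderiv ℝ Q q (1, 0)) p‖ ≤ C)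
    (hflat : ∀ p ∈ closedBall (u₀, v₀) ε,
      fderiv ℝ P p (0, 1) + Q p * P p = fderiv ℝ Q p (1, 0) + P p * Q p)
    {φ : ℝ → R} {ψ : ℝ → ℝ → R}
    (hφ : ∀ u ∈ Icc (u₀ - ε) (u₀ + ε),
      HasDerivWithinAt φ (φ u * P (u, v₀)) (Icc (u₀ - ε) (u₀ + ε)) u)
    (hψ₀ : ∀ u ∈ Icc (u₀ - ε) (u₀ + ε), ψ u v₀ = φ u)
    (hψ : ∀ u ∈ Icc (u₀ - ε) (u₀ + ε), ∀ v ∈ Icc (v₀ - ε) (v₀ + ε),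
      HasDerivWithinAt (ψ u) (ψ u v * Q (u, v)) (Icc (v₀ - ε) (v₀ + ε)) v)
    {u v : ℝ} (hu : u ∈ Ioo (u₀ - ε) (u₀ + ε)) (hv : v ∈ Icc (v₀ - ε) (v₀ + ε)) :
    HasDerivAt (fun s => ψ s v) (ψ u v * P (u, v)) u := by
  have hmem : ∀ {a b : ℝ}, a ∈ Icc (u₀ - ε) (u₀ + ε) → b ∈ Icc (v₀ - ε) (v₀ + ε) →
      (a, b) ∈ closedBall (u₀, v₀) ε := by
    intro a b ha hb
    rw [← closedBall_prod_same, Real.closedBall_eq_Icc, Real.closedBall_eq_Icc]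
    exact ⟨ha, hb⟩
  have hε : 0 < ε := by linarith [hu.1.trans hu.2]
  have hv₀ : v₀ ∈ Icc (v₀ - ε) (v₀ + ε) := by constructor <;> linarith
  have huI := Ioo_subset_Icc_self hu
  have hconv : Convex ℝ (closedBall (u₀, v₀) ε) := convex_closedBall _ _
  -- Lipschitz bounds in the first variable for `Q` and `Q_u`, then a first-order Taylor bound
  have hQlip : ∀ s ∈ Icc (u₀ - ε) (u₀ + ε), ∀ w ∈ Icc (v₀ - ε) (v₀ + ε),
      ‖Q (s, w) - Q (u, w)‖ ≤ C * |s - u| := by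
    intro s hs w hw
    have := hconv.norm_image_sub_le_of_norm_fderiv_le (𝕜 := ℝ) hQ bdQ (hmem huI hw) (hmem hs hw)
    simpa [Prod.norm_def] using this
  have hQulip : ∀ s ∈ Icc (u₀ - ε) (u₀ + ε), ∀ w ∈ Icc (v₀ - ε) (v₀ + ε),
      ‖fderiv ℝ Q (s, w) (1, 0) - fderiv ℝ Q (u, w) (1, 0)‖ ≤ C * |s - u| := by
    intro s hs w hw
    have := hconv.norm_image_sub_le_of_norm_fderiv_le (𝕜 := ℝ) hQu bdQu (hmem huI hw) (hmem hs hw)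
    simpa [Prod.norm_def] using this
  have hQtaylor : ∀ s ∈ Icc (u₀ - ε) (u₀ + ε), ∀ w ∈ Icc (v₀ - ε) (v₀ + ε),
      ‖Q (s, w) - Q (u, w) - (s - u) • fderiv ℝ Q (u, w) (1, 0)‖ ≤ C * |s - u| ^ 2 := by
    intro s hs w hw
    have hsub : uIcc u s ⊆ Icc (u₀ - ε) (u₀ + ε) := uIcc_subset_Icc huI hs
    have hd : ∀ x ∈ uIcc u s, HasDerivWithinAt
        (fun x => Q (x, w) - x • fderiv ℝ Q (u, w) (1, 0))
        (fderiv ℝ Q (x, w) (1, 0) - fderiv ℝ Q (u, w) (1, 0)) (uIcc u s) x := by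
      intro x hx
      have h1 : HasDerivAt (fun x : ℝ => (x, w)) ((1, 0) : ℝ × ℝ) x :=
        (hasDerivAt_id x).prodMk (hasDerivAt_const x w)
      have h2 := (hQ _ (hmem (hsub hx) hw)).hasFDerivAt.comp_hasDerivAt x h1
      have h3 := (hasDerivAt_id x).smul_const (fderiv ℝ Q (u, w) (1, 0))
      exact (h2.sub h3).hasDerivWithinAt.congr_deriv (by simp)
    have hbd : ∀ x ∈ uIcc u s,
        ‖fderiv ℝ Q (x, w) (1, 0) - fderiv ℝ Q (u, w) (1, 0)‖ ≤ C * |s - u| := fun x hx =>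
      (hQulip x (hsub hx) w hw).trans (by gcongr 1; exact abs_sub_left_of_mem_uIcc hx)
    have := (convex_uIcc u s).norm_image_sub_le_of_norm_hasDerivWithin_le hd hbd
      left_mem_uIcc right_mem_uIcc
    calc _ = ‖Q (s, w) - s • fderiv ℝ Q (u, w) (1, 0)
          - (Q (u, w) - u • fderiv ℝ Q (u, w) (1, 0))‖ := by congr 1; rw [sub_smul]; abel
      _ ≤ _ := this
      _ = _ := by rw [Real.norm_eq_abs]; ring
  set M : ℝ := 2 * ‖φ u‖ with hM
  have hψM : ∀ w ∈ Icc (v₀ - ε) (v₀ + ε), ‖ψ u w‖ ≤ M := by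
    intro w hw
    have := norm_le_of_norm_deriv_le (κ := 0) hC hCε (hψ u huI) (fun t ht => by
      rw [add_zero, mul_comm C]
      exact (norm_mul_le _ _).trans (by gcongr; exact bQ _ (hmem huI ht))) hw
    rw [hψ₀ u huI] at this
    linarith
  -- the error of the approximate solution, at height `w` over `s`
  set D : ℝ → ℝ → R := fun s w => ψ s w - ψ u w - (s - u) • (ψ u w * P (u, w)) with hD
  have key : ∀ s ∈ Icc (u₀ - ε) (u₀ + ε),
      ‖D s v‖ ≤ 2 * (‖D s v₀‖ + ε * (M * (C + C ^ 2) * |s - u| ^ 2)) := by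
    intro s hs
    refine norm_le_of_norm_deriv_le (f := D s) (t₀ := v₀)
      (f' := fun w => D s w * Q (s, w)
        + (ψ u w * (Q (s, w) - Q (u, w) - (s - u) • fderiv ℝ Q (u, w) (1, 0))
        + (s - u) • (ψ u w * P (u, w) * (Q (s, w) - Q (u, w))))) hC hCε (fun w hw => ?_)
        (fun w hw => ?_) hv
    · have h1 : HasDerivAt (fun w : ℝ => (u, w)) ((0, 1) : ℝ × ℝ) w :=
        (hasDerivAt_const w u).prodMk (hasDerivAt_id w)
      have h2 := ((hP _ (hmem huI hw)).hasFDerivAt.comp_hasDerivAt w h1).hasDerivWithinAt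
        (s := Icc (v₀ - ε) (v₀ + ε))
      have h3 := ((hψ s hs w hw).sub (hψ u huI w hw)).sub
        (((hψ u huI w hw).mul h2).const_smul (s - u))
      refine h3.congr_deriv ?_
      have hfl := hflat _ (hmem huI hw)
      have hPv : fderiv ℝ P (u, w) (0, 1)
          = fderiv ℝ Q (u, w) (1, 0) + P (u, w) * Q (u, w) - Q (u, w) * P (u, w) := by
        rw [← hfl]; abel
      simp only [hD, Function.comp_apply, hPv]
      simp only [mul_sub, sub_mul, mul_add, smul_sub, smul_add, smul_mul_assoc, mul_smul_comm,
        mul_assoc]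
      abel
    · have hψw := hψM w hw
      have e1 : ‖D s w * Q (s, w)‖ ≤ C * ‖D s w‖ := by
        rw [mul_comm C]
        exact (norm_mul_le _ _).trans (by gcongr; exact bQ _ (hmem hs hw))
      have e2 : ‖ψ u w * (Q (s, w) - Q (u, w) - (s - u) • fderiv ℝ Q (u, w) (1, 0))‖
          ≤ M * (C * |s - u| ^ 2) :=
        (norm_mul_le _ _).trans
          (mul_le_mul hψw (hQtaylor s hs w hw) (norm_nonneg _) (by positivity))
      have e3 : ‖(s - u) • (ψ u w * P (u, w) * (Q (s, w) - Q (u, w)))‖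
          ≤ |s - u| * (M * C * (C * |s - u|)) := by
        rw [norm_smul, Real.norm_eq_abs]
        gcongr
        refine (norm_mul_le _ _).trans (mul_le_mul ?_ (hQlip s hs w hw) (norm_nonneg _)
          (by positivity))
        exact (norm_mul_le _ _).trans
          (mul_le_mul hψw (bP _ (hmem huI hw)) (norm_nonneg _) (by positivity))
      calc _ ≤ C * ‖D s w‖ + (M * (C * |s - u| ^ 2) + |s - u| * (M * C * (C * |s - u|))) :=
            (norm_add_le _ _).trans (add_le_add e1 ((norm_add_le _ _).trans (add_le_add e2 e3)))
        _ = _ := by ring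
  have hnhds : Icc (u₀ - ε) (u₀ + ε) ∈ 𝓝 u := Icc_mem_nhds hu.1 hu.2
  have hφo : (fun s => D s v₀) =o[𝓝 u] fun s => s - u := by
    have h1 := ((hφ u huI).hasDerivAt hnhds).isLittleO
    refine h1.congr' ?_ (Eventually.of_forall fun _ => rfl)
    filter_upwards [hnhds] with s hs
    simp [hD, hψ₀ s hs, hψ₀ u huI]
  have hsq : (fun s => |s - u| ^ 2) =o[𝓝 u] fun s => s - u := by
    have h1 : (fun s : ℝ => s - u) =o[𝓝 u] fun _ => (1 : ℝ) := by
      rw [isLittleO_one_iff]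
      have : Tendsto (fun s : ℝ => s - u) (𝓝 u) (𝓝 (u - u)) :=
        (continuous_id.sub continuous_const).tendsto u
      simpa using this
    have h2 := h1.mul_isBigO (isBigO_refl (fun s : ℝ => s - u) (𝓝 u))
    simpa [sq_abs, pow_two] using h2
  have hDo : (fun s => D s v) =o[𝓝 u] fun s => s - u := by
    have hsum : (fun s => 2 * (‖D s v₀‖ + ε * (M * (C + C ^ 2) * |s - u| ^ 2)))
        =o[𝓝 u] fun s => s - u :=
      (hφo.norm_left.add ((hsq.const_mul_left _).const_mul_left _)).const_mul_left _
    refine IsBigO.trans_isLittleO ?_ hsum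
    refine IsBigO.of_bound 1 ?_
    filter_upwards [hnhds] with s hs
    rw [one_mul]
    exact (key s hs).trans (le_abs_self _)
  rw [hasDerivAt_iff_isLittleO]
  exact hDo

/-- Smoothness of a solution of a total system with smooth coefficients. -/
theorem contDiffOn_of_total_system {V : Set (ℝ × ℝ)} (hV : IsOpen V) {P Q Y : ℝ × ℝ → R}
    (hP : ContDiffOn ℝ ∞ P V) (hQ : ContDiffOn ℝ ∞ Q V)
    (hY : ∀ p ∈ V, HasFDerivAt Y ((ContinuousLinearMap.fst ℝ ℝ ℝ).smulRight (Y p * P p)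
      + (ContinuousLinearMap.snd ℝ ℝ ℝ).smulRight (Y p * Q p)) p) :
    ContDiffOn ℝ ∞ Y V := by
  have hdiff : DifferentiableOn ℝ Y V := fun p hp =>
    (hY p hp).differentiableAt.differentiableWithinAt
  rw [contDiffOn_infty]
  intro n
  induction n with
  | zero => exact contDiffOn_zero.2 hdiff.continuousOn
  | succ n ih =>
    rw [Nat.cast_add, Nat.cast_one, contDiffOn_succ_iff_fderiv_of_isOpen hV]
    refine ⟨hdiff, by simp, ?_⟩
    have hP' : ContDiffOn ℝ n P V := hP.of_le (by exact_mod_cast le_top)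
    have hQ' : ContDiffOn ℝ n Q V := hQ.of_le (by exact_mod_cast le_top)
    refine ContDiffOn.congr ?_ fun p hp => (hY p hp).fderiv
    exact (contDiffOn_const.smulRight (ih.mul hP')).add (contDiffOn_const.smulRight (ih.mul hQ'))

/-- The Frobenius theorem for linear systems `Y_u = Y P`, `Y_v = Y Q` in a Banach algebra: if the
connection `(P, Q)` is flat, then there is a smooth local solution with any prescribed value. -/
theorem exists_solution_of_flat [CompleteSpace R] {U : Set (ℝ × ℝ)} (hU : IsOpen U)
    {P Q : ℝ × ℝ → R}
    (hP : ContDiffOn ℝ ∞ P U) (hQ : ContDiffOn ℝ ∞ Q U)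
    (hflat : ∀ p ∈ U, fderiv ℝ P p (0, 1) + Q p * P p = fderiv ℝ Q p (1, 0) + P p * Q p)
    {p₀ : ℝ × ℝ} (hp₀ : p₀ ∈ U) (Y₀ : R) :
    ∃ ε > 0, ball p₀ ε ⊆ U ∧ ∃ Y : ℝ × ℝ → R, Y p₀ = Y₀ ∧ ContDiffOn ℝ ∞ Y (ball p₀ ε) ∧
      ∀ p ∈ ball p₀ ε, HasFDerivAt Y ((ContinuousLinearMap.fst ℝ ℝ ℝ).smulRight (Y p * P p)
        + (ContinuousLinearMap.snd ℝ ℝ ℝ).smulRight (Y p * Q p)) p := by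
  obtain ⟨u₀, v₀⟩ := p₀
  have hdQ : ContDiffOn ℝ ∞ (fderiv ℝ Q) U := ((contDiffOn_infty_iff_fderiv_of_isOpen hU).1 hQ).2
  have hQu : ContDiffOn ℝ ∞ (fun q => fderiv ℝ Q q (1, 0)) U := hdQ.clm_apply contDiffOn_const
  have hdQu : ContDiffOn ℝ ∞ (fderiv ℝ fun q => fderiv ℝ Q q (1, 0)) U :=
    ((contDiffOn_infty_iff_fderiv_of_isOpen hU).1 hQu).2
  have hbdd : ∀ {X : Type _} [NormedAddCommGroup X] (g : ℝ × ℝ → X), ContinuousOn g U →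
      ∀ c, ‖g (u₀, v₀)‖ < c → ∀ᶠ p in 𝓝 (u₀, v₀), ‖g p‖ ≤ c := by
    intro X _ g hg c hc
    have h1 : ContinuousAt (fun p => ‖g p‖) (u₀, v₀) :=
      (hg.continuousAt (hU.mem_nhds hp₀)).norm
    exact (h1.eventually_lt continuousAt_const hc).mono fun p hp => hp.le
  set C : ℝ := ‖P (u₀, v₀)‖ + ‖Q (u₀, v₀)‖ + ‖fderiv ℝ Q (u₀, v₀)‖
    + ‖fderiv ℝ (fun q => fderiv ℝ Q q (1, 0)) (u₀, v₀)‖ + 1 with hC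
  have n1 := norm_nonneg (P (u₀, v₀))
  have n2 := norm_nonneg (Q (u₀, v₀))
  have n3 := norm_nonneg (fderiv ℝ Q (u₀, v₀))
  have n4 := norm_nonneg (fderiv ℝ (fun q => fderiv ℝ Q q (1, 0)) (u₀, v₀))
  have hC0 : 0 < C := by positivity
  have hev : ∀ᶠ p in 𝓝 (u₀, v₀), p ∈ U ∧ ‖P p‖ ≤ C ∧ ‖Q p‖ ≤ C ∧ ‖fderiv ℝ Q p‖ ≤ C ∧
      ‖fderiv ℝ (fun q => fderiv ℝ Q q (1, 0)) p‖ ≤ C :=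
    (hU.eventually_mem hp₀).and <| (hbdd _ hP.continuousOn C (by linarith)).and <|
      (hbdd _ hQ.continuousOn C (by linarith)).and <|
      (hbdd _ hdQ.continuousOn C (by linarith)).and <|
      (hbdd _ hdQu.continuousOn C (by linarith))
  obtain ⟨r, hr, hball⟩ := Metric.nhds_basis_closedBall.eventually_iff.1 hev
  set ε : ℝ := min r (1 / (2 * C)) with hεdef
  have hε : 0 < ε := lt_min hr (by positivity)
  have hCε : C * ε ≤ 1 / 2 := by
    calc C * ε ≤ C * (1 / (2 * C)) := by gcongr; exact min_le_right _ _
      _ = 1 / 2 := by field_simp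
  have hB : ∀ p ∈ closedBall (u₀, v₀) ε, p ∈ U ∧ ‖P p‖ ≤ C ∧ ‖Q p‖ ≤ C ∧ ‖fderiv ℝ Q p‖ ≤ C ∧
      ‖fderiv ℝ (fun q => fderiv ℝ Q q (1, 0)) p‖ ≤ C := fun p hp =>
    hball (closedBall_subset_closedBall (min_le_left _ _) hp)
  have hdiff : ∀ {X : Type _} [NormedAddCommGroup X] [NormedSpace ℝ X] {g : ℝ × ℝ → X},
      ContDiffOn ℝ ∞ g U → ∀ p ∈ closedBall (u₀, v₀) ε, DifferentiableAt ℝ g p :=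
    fun hg p hp => (hg.contDiffAt (hU.mem_nhds (hB p hp).1)).differentiableAt (by simp)
  have hmem : ∀ {a b : ℝ}, a ∈ Icc (u₀ - ε) (u₀ + ε) → b ∈ Icc (v₀ - ε) (v₀ + ε) →
      (a, b) ∈ closedBall (u₀, v₀) ε := by
    intro a b ha hb
    rw [← closedBall_prod_same, Real.closedBall_eq_Icc, Real.closedBall_eq_Icc]
    exact ⟨ha, hb⟩
  have hu₀ : u₀ ∈ Icc (u₀ - ε) (u₀ + ε) := by constructor <;> linarith
  have hv₀ : v₀ ∈ Icc (v₀ - ε) (v₀ + ε) := by constructor <;> linarith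
  obtain ⟨φ, hφ₀, hφ⟩ := exists_linear_ode (A := fun u => P (u, v₀)) hε.le hC0.le hCε
    (fun u hu => ((hdiff hP _ (hmem hu hv₀)).continuousAt.comp
      (f := fun u : ℝ => (u, v₀)) (by fun_prop)).continuousWithinAt)
    (fun u hu => (hB _ (hmem hu hv₀)).2.1) Y₀
  have hex : ∀ u, ∃ y : ℝ → R, u ∈ Icc (u₀ - ε) (u₀ + ε) → y v₀ = φ u ∧
      ∀ v ∈ Icc (v₀ - ε) (v₀ + ε),
        HasDerivWithinAt y (y v * Q (u, v)) (Icc (v₀ - ε) (v₀ + ε)) v := by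
    intro u
    by_cases hu : u ∈ Icc (u₀ - ε) (u₀ + ε)
    · obtain ⟨y, hy⟩ := exists_linear_ode (A := fun v => Q (u, v)) hε.le hC0.le hCε
        (fun v hv => ((hdiff hQ _ (hmem hu hv)).continuousAt.comp
          (f := fun v : ℝ => (u, v)) (by fun_prop)).continuousWithinAt)
        (fun v hv => (hB _ (hmem hu hv)).2.2.1) (φ u)
      exact ⟨y, fun _ => hy⟩
    · exact ⟨0, fun h => absurd h hu⟩
  choose ψ hψ using hex
  have hsub : ball (u₀, v₀) ε ⊆ U := fun p hp => (hB p (ball_subset_closedBall hp)).1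
  have hprod : ∀ p ∈ ball (u₀, v₀) ε,
      p.1 ∈ Ioo (u₀ - ε) (u₀ + ε) ∧ p.2 ∈ Ioo (v₀ - ε) (v₀ + ε) := by
    intro p hp
    rw [← ball_prod_same, Real.ball_eq_Ioo, Real.ball_eq_Ioo] at hp
    exact hp
  have hdu : ∀ p ∈ ball (u₀, v₀) ε,
      HasDerivAt (fun s => ψ s p.2) (ψ p.1 p.2 * P p) p.1 := by
    intro p hp
    exact hasDerivAt_of_flat hC0.le hCε (hdiff hP) (hdiff hQ) (hdiff hQu)
      (fun p hp => (hB p hp).2.1) (fun p hp => (hB p hp).2.2.1) (fun p hp => (hB p hp).2.2.2.1)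
      (fun p hp => (hB p hp).2.2.2.2) (fun p hp => hflat p (hB p hp).1) hφ
      (fun u hu => (hψ u hu).1) (fun u hu => (hψ u hu).2) (hprod p hp).1
      (Ioo_subset_Icc_self (hprod p hp).2)
  have hdv : ∀ p ∈ ball (u₀, v₀) ε, HasDerivAt (ψ p.1) (ψ p.1 p.2 * Q p) p.2 := by
    intro p hp
    obtain ⟨hp1, hp2⟩ := hprod p hp
    exact ((hψ p.1 (Ioo_subset_Icc_self hp1)).2 p.2 (Ioo_subset_Icc_self hp2)).hasDerivAt
      (Icc_mem_nhds hp2.1 hp2.2)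
  set M : ℝ := 4 * ‖Y₀‖ with hM
  have hψM : ∀ p ∈ ball (u₀, v₀) ε, ‖ψ p.1 p.2‖ ≤ M := by
    intro p hp
    have hp1 := Ioo_subset_Icc_self (hprod p hp).1
    have h1 := norm_le_of_norm_deriv_le (κ := 0) hC0.le hCε (hψ p.1 hp1).2 (fun t ht => by
      rw [add_zero, mul_comm C]
      exact (norm_mul_le _ _).trans (by gcongr; exact (hB _ (hmem hp1 ht)).2.2.1))
      (Ioo_subset_Icc_self (hprod p hp).2)
    have h2 := norm_le_of_norm_deriv_le (κ := 0) hC0.le hCε hφ (fun t ht => by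
      rw [add_zero, mul_comm C]
      exact (norm_mul_le _ _).trans (by gcongr; exact (hB _ (hmem ht hv₀)).2.1)) hp1
    rw [(hψ p.1 hp1).1] at h1
    rw [hφ₀] at h2
    linarith
  have hcont : ∀ p ∈ ball (u₀, v₀) ε, ContinuousAt (fun q : ℝ × ℝ => ψ q.1 q.2) p := by
    intro p hp
    have hlip : ∀ q ∈ ball (u₀, v₀) ε,
        ‖ψ q.1 q.2 - ψ p.1 p.2‖ ≤ M * C * ‖q.1 - p.1‖ + M * C * ‖q.2 - p.2‖ := by
      intro q hq
      have h1 := (convex_Ioo (u₀ - ε) (u₀ + ε)).norm_image_sub_le_of_norm_hasDerivWithin_le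
        (f := fun s => ψ s q.2) (f' := fun s => ψ s q.2 * P (s, q.2)) (C := M * C)
        (fun s hs => (hdu (s, q.2) (by
          rw [← ball_prod_same, Real.ball_eq_Ioo, Real.ball_eq_Ioo]
          exact ⟨hs, (hprod q hq).2⟩)).hasDerivWithinAt)
        (fun s hs => by
          have hsq : (s, q.2) ∈ ball (u₀, v₀) ε := by
            rw [← ball_prod_same, Real.ball_eq_Ioo, Real.ball_eq_Ioo]
            exact ⟨hs, (hprod q hq).2⟩
          exact (norm_mul_le _ _).trans (mul_le_mul (hψM _ hsq)
            (hB _ (ball_subset_closedBall hsq)).2.1 (norm_nonneg _) (by positivity)))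
        (hprod p hp).1 (hprod q hq).1
      have h2 := (convex_Ioo (v₀ - ε) (v₀ + ε)).norm_image_sub_le_of_norm_hasDerivWithin_le
        (f := ψ p.1) (f' := fun s => ψ p.1 s * Q (p.1, s)) (C := M * C)
        (fun s hs => (hdv (p.1, s) (by
          rw [← ball_prod_same, Real.ball_eq_Ioo, Real.ball_eq_Ioo]
          exact ⟨(hprod p hp).1, hs⟩)).hasDerivWithinAt)
        (fun s hs => by
          have hsq : (p.1, s) ∈ ball (u₀, v₀) ε := by
            rw [← ball_prod_same, Real.ball_eq_Ioo, Real.ball_eq_Ioo]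
            exact ⟨(hprod p hp).1, hs⟩
          exact (norm_mul_le _ _).trans (mul_le_mul (hψM _ hsq)
            (hB _ (ball_subset_closedBall hsq)).2.2.1 (norm_nonneg _) (by positivity)))
        (hprod p hp).2 (hprod q hq).2
      calc ‖ψ q.1 q.2 - ψ p.1 p.2‖
          ≤ ‖ψ q.1 q.2 - ψ p.1 q.2‖ + ‖ψ p.1 q.2 - ψ p.1 p.2‖ := norm_sub_le_norm_sub_add_norm_sub ..
        _ ≤ _ := add_le_add h1 h2
    rw [ContinuousAt, tendsto_iff_norm_sub_tendsto_zero]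
    have hlim : Tendsto (fun q : ℝ × ℝ => M * C * ‖q.1 - p.1‖ + M * C * ‖q.2 - p.2‖)
        (𝓝 p) (𝓝 0) := by
      have : Continuous (fun q : ℝ × ℝ => M * C * ‖q.1 - p.1‖ + M * C * ‖q.2 - p.2‖) := by fun_prop
      simpa using this.tendsto p
    refine squeeze_zero' (Eventually.of_forall fun _ => norm_nonneg _) ?_ hlim
    filter_upwards [isOpen_ball.mem_nhds hp] with q hq using hlip q hq
  have hYd : ∀ p ∈ ball (u₀, v₀) ε, HasFDerivAt (fun q : ℝ × ℝ => ψ q.1 q.2)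
      ((ContinuousLinearMap.fst ℝ ℝ ℝ).smulRight (ψ p.1 p.2 * P p)
        + (ContinuousLinearMap.snd ℝ ℝ ℝ).smulRight (ψ p.1 p.2 * Q p)) p := by
    intro p hp
    have hc := hcont p hp
    have hPc := (hdiff hP p (ball_subset_closedBall hp)).continuousAt
    have hQc := (hdiff hQ p (ball_subset_closedBall hp)).continuousAt
    have h := hasStrictFDerivAt_uncurry_coprod (𝕜 := ℝ) (u := p) (f := ψ)
      (f₁ := fun a b => (ContinuousLinearMap.toSpanSingleton ℝ (ψ a b * P (a, b))))
      (f₂ := fun a b => (ContinuousLinearMap.toSpanSingleton ℝ (ψ a b * Q (a, b))))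
      (by filter_upwards [isOpen_ball.mem_nhds hp] with q hq using (hdu q hq).hasFDerivAt)
      (by filter_upwards [isOpen_ball.mem_nhds hp] with q hq using (hdv q hq).hasFDerivAt)
      ((ContinuousLinearMap.toSpanSingletonCLE (𝕜 := ℝ)).continuous.continuousAt.comp (hc.mul hPc))
      ((ContinuousLinearMap.toSpanSingletonCLE (𝕜 := ℝ)).continuous.continuousAt.comp (hc.mul hQc))
    refine h.hasFDerivAt.congr_fderiv ?_
    ext <;> simp [Function.HasUncurry.uncurry]
  refine ⟨ε, hε, hsub, fun q => ψ q.1 q.2, ?_, ?_, hYd⟩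
  · simp only [(hψ u₀ hu₀).1, hφ₀]
  · exact contDiffOn_of_total_system isOpen_ball (hP.mono hsub) (hQ.mono hsub) hYd

end BanachAlgebra

/-! ### Calculus of matrix-valued maps -/

/-- The derivative of a matrix-valued map in the direction `ξ`, taken entrywise; `matDu` and `matDv`
are the cases `ξ = (1, 0)` and `ξ = (0, 1)`. -/
def matD {m n : ℕ} (ξ : ℝ × ℝ) (M : ℝ × ℝ → Matrix (Fin m) (Fin n) ℝ) (p : ℝ × ℝ) :
    Matrix (Fin m) (Fin n) ℝ :=
  Matrix.of fun i j => fderiv ℝ (fun q => M q i j) p ξ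

section Calculus

variable {l m n : ℕ} {U : Set (ℝ × ℝ)} {p : ℝ × ℝ}

theorem SmoothOn.contDiffAt {f : ℝ × ℝ → ℝ} (hf : SmoothOn U f) (hU : IsOpen U) (hp : p ∈ U) :
    ContDiffAt ℝ ∞ f p :=
  ContDiffOn.contDiffAt hf (hU.mem_nhds hp)

theorem SmoothOn.differentiableAt {f : ℝ × ℝ → ℝ} (hf : SmoothOn U f) (hU : IsOpen U)
    (hp : p ∈ U) : DifferentiableAt ℝ f p :=
  (hf.contDiffAt hU hp).differentiableAt (by simp)

theorem SmoothOn.fderiv_apply {f : ℝ × ℝ → ℝ} (hf : SmoothOn U f) (hU : IsOpen U) (ξ : ℝ × ℝ) :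
    SmoothOn U fun p => fderiv ℝ f p ξ :=
  ((contDiffOn_infty_iff_fderiv_of_isOpen hU).1 hf).2.clm_apply contDiffOn_const

theorem SmoothOn.fderiv_comm {f : ℝ × ℝ → ℝ} (hf : SmoothOn U f) (hU : IsOpen U) (hp : p ∈ U)
    (ξ η : ℝ × ℝ) :
    fderiv ℝ (fun q => fderiv ℝ f q ξ) p η = fderiv ℝ (fun q => fderiv ℝ f q η) p ξ := by
  have h2 : DifferentiableAt ℝ (fderiv ℝ f) p :=
    (((contDiffOn_infty_iff_fderiv_of_isOpen hU).1 hf).2.contDiffAt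
      (hU.mem_nhds hp)).differentiableAt (by simp)
  have hs : IsSymmSndFDerivAt ℝ f p := (hf.contDiffAt hU hp).isSymmSndFDerivAt (by
    simp only [minSmoothness_of_isRCLikeNormedField]
    exact ENat.LEInfty.out)
  rw [fderiv_clm_apply h2 (differentiableAt_const _), fderiv_clm_apply h2 (differentiableAt_const _)]
  simpa using hs.eq η ξ

theorem MatSmoothOn.mul {A : ℝ × ℝ → Matrix (Fin l) (Fin m) ℝ}
    {B : ℝ × ℝ → Matrix (Fin m) (Fin n) ℝ} (hA : MatSmoothOn U A) (hB : MatSmoothOn U B) :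
    MatSmoothOn U fun p => A p * B p := by
  intro i j
  simp only [Matrix.mul_apply]
  exact ContDiffOn.sum fun a _ => ContDiffOn.mul (hA i a) (hB a j)

theorem MatSmoothOn.transpose {A : ℝ × ℝ → Matrix (Fin m) (Fin n) ℝ} (hA : MatSmoothOn U A) :
    MatSmoothOn U fun p => (A p)ᵀ :=
  fun i j => hA j i

theorem MatSmoothOn.add {A B : ℝ × ℝ → Matrix (Fin m) (Fin n) ℝ} (hA : MatSmoothOn U A)
    (hB : MatSmoothOn U B) : MatSmoothOn U fun p => A p + B p :=
  fun i j => ContDiffOn.add (hA i j) (hB i j)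

theorem MatSmoothOn.sub {A B : ℝ × ℝ → Matrix (Fin m) (Fin n) ℝ} (hA : MatSmoothOn U A)
    (hB : MatSmoothOn U B) : MatSmoothOn U fun p => A p - B p :=
  fun i j => ContDiffOn.sub (hA i j) (hB i j)

theorem MatSmoothOn.matD {A : ℝ × ℝ → Matrix (Fin m) (Fin n) ℝ} (hA : MatSmoothOn U A)
    (hU : IsOpen U) (ξ : ℝ × ℝ) : MatSmoothOn U (matD ξ A) :=
  fun i j => (hA i j).fderiv_apply hU ξ

theorem MatSmoothOn.mono {V : Set (ℝ × ℝ)} {A : ℝ × ℝ → Matrix (Fin m) (Fin n) ℝ}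
    (hA : MatSmoothOn U A) (h : V ⊆ U) : MatSmoothOn V A :=
  fun i j => ContDiffOn.mono (hA i j) h

theorem matD_mul {A : ℝ × ℝ → Matrix (Fin l) (Fin m) ℝ}
    {B : ℝ × ℝ → Matrix (Fin m) (Fin n) ℝ} (hA : MatSmoothOn U A) (hB : MatSmoothOn U B)
    (hU : IsOpen U) (hp : p ∈ U) (ξ : ℝ × ℝ) :
    matD ξ (fun q => A q * B q) p = matD ξ A p * B p + A p * matD ξ B p := by
  ext i j
  simp only [matD, Matrix.of_apply, Matrix.add_apply, Matrix.mul_apply]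
  have hd : ∀ a ∈ Finset.univ, DifferentiableAt ℝ (fun q => A q i a * B q a j) p := fun a _ =>
    ((hA i a).differentiableAt hU hp).mul ((hB a j).differentiableAt hU hp)
  rw [fderiv_fun_sum hd, sum_apply, ← Finset.sum_add_distrib]
  refine Finset.sum_congr rfl fun a _ => ?_
  rw [fderiv_fun_mul ((hA i a).differentiableAt hU hp) ((hB a j).differentiableAt hU hp)]
  simp only [add_apply, smul_apply, smul_eq_mul]
  ring

theorem matD_transpose (A : ℝ × ℝ → Matrix (Fin m) (Fin n) ℝ) (ξ : ℝ × ℝ) :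
    matD ξ (fun q => (A q)ᵀ) p = (matD ξ A p)ᵀ := rfl

theorem matD_add {A B : ℝ × ℝ → Matrix (Fin m) (Fin n) ℝ} (hA : MatSmoothOn U A)
    (hB : MatSmoothOn U B) (hU : IsOpen U) (hp : p ∈ U) (ξ : ℝ × ℝ) :
    matD ξ (fun q => A q + B q) p = matD ξ A p + matD ξ B p := by
  ext i j
  simp only [matD, Matrix.of_apply, Matrix.add_apply]
  rw [fderiv_fun_add ((hA i j).differentiableAt hU hp) ((hB i j).differentiableAt hU hp)]
  rfl

theorem matD_congr {A B : ℝ × ℝ → Matrix (Fin m) (Fin n) ℝ} (hU : IsOpen U) (hp : p ∈ U)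
    (h : ∀ q ∈ U, A q = B q) (ξ : ℝ × ℝ) : matD ξ A p = matD ξ B p := by
  ext i j
  simp only [matD, Matrix.of_apply]
  have : (fun q => A q i j) =ᶠ[𝓝 p] fun q => B q i j := by
    filter_upwards [hU.mem_nhds hp] with q hq
    rw [h q hq]
  rw [this.fderiv_eq]

theorem matD_const (C : Matrix (Fin m) (Fin n) ℝ) (ξ : ℝ × ℝ) : matD ξ (fun _ => C) p = 0 := by
  ext i j
  simp [matD]

theorem matD_comm {A : ℝ × ℝ → Matrix (Fin m) (Fin n) ℝ} (hA : MatSmoothOn U A)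
    (hU : IsOpen U) (hp : p ∈ U) (ξ η : ℝ × ℝ) :
    matD η (matD ξ A) p = matD ξ (matD η A) p := by
  ext i j
  exact (hA i j).fderiv_comm hU hp ξ η

theorem matSmoothOn_const (C : Matrix (Fin m) (Fin n) ℝ) : MatSmoothOn U fun _ => C :=
  fun _ _ => contDiffOn_const

/-- A function on a connected open set with vanishing partial derivatives is constant. -/
theorem eq_of_partials_eq_zero {f : ℝ × ℝ → ℝ} (hU : IsOpen U) (hc : IsPreconnected U)
    (hf : ∀ p ∈ U, DifferentiableAt ℝ f p) (hu : ∀ p ∈ U, fderiv ℝ f p (1, 0) = 0)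
    (hv : ∀ p ∈ U, fderiv ℝ f p (0, 1) = 0) {q : ℝ × ℝ} (hp : p ∈ U) (hq : q ∈ U) :
    f p = f q := by
  refine hU.is_const_of_fderiv_eq_zero (𝕜 := ℝ) hc
    (fun r hr => (hf r hr).differentiableWithinAt) (fun r hr => ?_) hp hq
  ext
  · simpa using hu r hr
  · simpa using hv r hr

theorem eq_of_matD_eq_zero {A : ℝ × ℝ → Matrix (Fin m) (Fin n) ℝ} (hA : MatSmoothOn U A)
    (hU : IsOpen U) (hc : IsPreconnected U) (hu : ∀ p ∈ U, matD (1, 0) A p = 0)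
    (hv : ∀ p ∈ U, matD (0, 1) A p = 0) {q : ℝ × ℝ} (hp : p ∈ U) (hq : q ∈ U) : A p = A q := by
  ext i j
  exact eq_of_partials_eq_zero hU hc (fun r hr => (hA i j).differentiableAt hU hr)
    (fun r hr => congrFun (congrFun (hu r hr) i) j)
    (fun r hr => congrFun (congrFun (hv r hr) i) j) hp hq

/-- Continuous functions on `U` that agree off a set with empty interior agree on `U`. -/
theorem eqOn_of_eqOn_off {d f g : ℝ × ℝ → ℝ} (hU : IsOpen U) (hd : interior {p ∈ U | d p = 0} = ∅)
    (hf : ContinuousOn f U) (hg : ContinuousOn g U) (h : ∀ p ∈ U, d p ≠ 0 → f p = g p) :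
    ∀ p ∈ U, f p = g p := by
  intro p hp
  by_contra hne
  have hopen : IsOpen (U ∩ (fun q => f q - g q) ⁻¹' {0}ᶜ) :=
    (hf.sub hg).isOpen_inter_preimage hU isOpen_compl_singleton
  have hsub : U ∩ (fun q => f q - g q) ⁻¹' {0}ᶜ ⊆ interior {p ∈ U | d p = 0} := by
    refine interior_maximal (fun q hq => ⟨hq.1, ?_⟩) hopen
    by_contra hdq
    exact hq.2 (by simp [h q hq.1 hdq])
  rw [hd] at hsub
  exact hsub ⟨hp, by simpa [sub_eq_zero] using hne⟩

theorem matrix_eqOn_of_eqOn_off {d : ℝ × ℝ → ℝ} {A B : ℝ × ℝ → Matrix (Fin m) (Fin n) ℝ}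
    (hU : IsOpen U) (hd : interior {p ∈ U | d p = 0} = ∅) (hA : MatSmoothOn U A)
    (hB : MatSmoothOn U B) (h : ∀ p ∈ U, d p ≠ 0 → A p = B p) : ∀ p ∈ U, A p = B p := by
  intro p hp
  ext i j
  exact eqOn_of_eqOn_off (f := fun p => A p i j) (g := fun p => B p i j) hU hd
    (hA i j).continuousOn (hB i j).continuousOn (fun q hq hdq => by rw [h q hq hdq]) p hp

/-- A closed `1`-form `α du + β dv` on a convex open set has a primitive. -/
theorem exists_primitive (hU : IsOpen U) (hc : Convex ℝ U) {α β : ℝ × ℝ → ℝ} (hα : SmoothOn U α)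
    (hβ : SmoothOn U β) (hcl : ∀ p ∈ U, fderiv ℝ α p (0, 1) = fderiv ℝ β p (1, 0)) :
    ∃ f : ℝ × ℝ → ℝ, SmoothOn U f ∧ ∀ p ∈ U, du f p = α p ∧ dv f p = β p := by
  set θ : ℝ × ℝ → (ℝ × ℝ →L[ℝ] ℝ) := fun p =>
    α p • ContinuousLinearMap.fst ℝ ℝ ℝ + β p • ContinuousLinearMap.snd ℝ ℝ ℝ with h_form
  have h_smooth : ContDiffOn ℝ ∞ θ U :=
    (ContDiffOn.smul hα contDiffOn_const).add (ContDiffOn.smul hβ contDiffOn_const)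
  have h_diff : DifferentiableOn ℝ θ U := h_smooth.differentiableOn (by simp)
  have hsymm : ∀ p ∈ U, ∀ x y, fderiv ℝ θ p x y = fderiv ℝ θ p y x := by
    intro p hp x y
    have h1 := (((hα.differentiableAt hU hp).hasFDerivAt.smul_const
      (ContinuousLinearMap.fst ℝ ℝ ℝ)).add ((hβ.differentiableAt hU hp).hasFDerivAt.smul_const
      (ContinuousLinearMap.snd ℝ ℝ ℝ))).fderiv
    have h2 : fderiv ℝ θ p = _ := h1
    have hx : ∀ (φ : ℝ × ℝ →L[ℝ] ℝ) (z : ℝ × ℝ), φ z = z.1 * φ (1, 0) + z.2 * φ (0, 1) := by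
      intro φ z
      have hz : z = z.1 • ((1, 0) : ℝ × ℝ) + z.2 • ((0, 1) : ℝ × ℝ) := by ext <;> simp
      calc φ z = φ (z.1 • ((1, 0) : ℝ × ℝ) + z.2 • ((0, 1) : ℝ × ℝ)) := congrArg φ hz
        _ = _ := by rw [map_add, map_smul, map_smul, smul_eq_mul, smul_eq_mul]
    rw [h2]
    simp only [add_apply, ContinuousLinearMap.smulRight_apply,
      smul_apply, ContinuousLinearMap.coe_fst', ContinuousLinearMap.coe_snd',
      smul_eq_mul]
    rw [hx (fderiv ℝ α p) x, hx (fderiv ℝ α p) y, hx (fderiv ℝ β p) x, hx (fderiv ℝ β p) y,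
      hcl p hp]
    ring
  obtain ⟨f, hf⟩ := hc.exists_forall_hasFDerivAt_of_fderiv_symmetric hU h_diff hsymm
  refine ⟨f, ?_, fun p hp => ?_⟩
  · refine (contDiffOn_infty_iff_fderiv_of_isOpen hU).2
      ⟨fun p hp => (hf p hp).differentiableAt.differentiableWithinAt, ?_⟩
    exact h_smooth.congr fun p hp => (hf p hp).fderiv
  · simp [du, dv, (hf p hp).fderiv, h_form]

end Calculus

/-! ### Connection matrices -/

section Connection

variable {n : ℕ} {U : Set (ℝ × ℝ)} {p : ℝ × ℝ}

/-- The curvature of the connection `(P, Q)` that governs frames `W` with `W_u = W P` and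
`W_v = W Q`: the obstruction to `W_uv = W_vu`. -/
def curvature (P Q : ℝ × ℝ → Matrix (Fin n) (Fin n) ℝ) (p : ℝ × ℝ) : Matrix (Fin n) (Fin n) ℝ :=
  matD (0, 1) P p - matD (1, 0) Q p + Q p * P p - P p * Q p

theorem MatSmoothOn.curvature {P Q : ℝ × ℝ → Matrix (Fin n) (Fin n) ℝ} (hU : IsOpen U)
    (hP : MatSmoothOn U P) (hQ : MatSmoothOn U Q) : MatSmoothOn U (curvature P Q) :=
  (((hP.matD hU _).sub (hQ.matD hU _)).add (hQ.mul hP)).sub (hP.mul hQ)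

/-- The curvature is conjugated by a change of frame. -/
theorem mul_curvature_of_gauge {P Q P' Q' T : ℝ × ℝ → Matrix (Fin n) (Fin n) ℝ} (hU : IsOpen U)
    (hP : MatSmoothOn U P) (hQ : MatSmoothOn U Q) (hP' : MatSmoothOn U P')
    (hQ' : MatSmoothOn U Q') (hT : MatSmoothOn U T)
    (hu : ∀ p ∈ U, T p * P' p = P p * T p + matD (1, 0) T p)
    (hv : ∀ p ∈ U, T p * Q' p = Q p * T p + matD (0, 1) T p) (hp : p ∈ U) :
    T p * curvature P' Q' p = curvature P Q p * T p := by
  have e1 : matD (0, 1) T p * P' p + T p * matD (0, 1) P' p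
      = matD (0, 1) P p * T p + P p * matD (0, 1) T p + matD (0, 1) (matD (1, 0) T) p := by
    rw [← matD_mul hT hP' hU hp, matD_congr hU hp hu,
      matD_add (hP.mul hT) (hT.matD hU _) hU hp, matD_mul hP hT hU hp]
  have e2 : matD (1, 0) T p * Q' p + T p * matD (1, 0) Q' p
      = matD (1, 0) Q p * T p + Q p * matD (1, 0) T p + matD (0, 1) (matD (1, 0) T) p := by
    rw [matD_comm hT hU hp, ← matD_mul hT hQ' hU hp, matD_congr hU hp hv,
      matD_add (hQ.mul hT) (hT.matD hU _) hU hp, matD_mul hQ hT hU hp]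
  have hTu : matD (1, 0) T p = T p * P' p - P p * T p := by rw [hu p hp]; abel
  have hTv : matD (0, 1) T p = T p * Q' p - Q p * T p := by rw [hv p hp]; abel
  have e1' : T p * matD (0, 1) P' p = matD (0, 1) P p * T p + P p * matD (0, 1) T p
      + matD (0, 1) (matD (1, 0) T) p - matD (0, 1) T p * P' p := by rw [← e1]; abel
  have e2' : T p * matD (1, 0) Q' p = matD (1, 0) Q p * T p + Q p * matD (1, 0) T p
      + matD (0, 1) (matD (1, 0) T) p - matD (1, 0) T p * Q' p := by rw [← e2]; abel
  simp only [curvature, mul_add, mul_sub, add_mul, sub_mul]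
  rw [e1', e2', hTu, hTv]
  noncomm_ring

/-- The curvature of a metric connection is skew with respect to the metric. -/
theorem metric_mul_curvature_add_transpose {H P Q : ℝ × ℝ → Matrix (Fin n) (Fin n) ℝ}
    (hU : IsOpen U) (hH : MatSmoothOn U H) (hP : MatSmoothOn U P) (hQ : MatSmoothOn U Q)
    (hsymm : ∀ p ∈ U, (H p)ᵀ = H p)
    (hu : ∀ p ∈ U, matD (1, 0) H p = H p * P p + (H p * P p)ᵀ)
    (hv : ∀ p ∈ U, matD (0, 1) H p = H p * Q p + (H p * Q p)ᵀ) (hp : p ∈ U) :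
    H p * curvature P Q p + (H p * curvature P Q p)ᵀ = 0 := by
  have e1 : matD (0, 1) (matD (1, 0) H) p
      = matD (0, 1) H p * P p + H p * matD (0, 1) P p
        + (matD (0, 1) H p * P p + H p * matD (0, 1) P p)ᵀ := by
    rw [matD_congr hU hp hu, matD_add (hH.mul hP) (hH.mul hP).transpose hU hp, matD_transpose,
      matD_mul hH hP hU hp]
  have e2 : matD (0, 1) (matD (1, 0) H) p
      = matD (1, 0) H p * Q p + H p * matD (1, 0) Q p
        + (matD (1, 0) H p * Q p + H p * matD (1, 0) Q p)ᵀ := by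
    rw [matD_comm hH hU hp, matD_congr hU hp hv,
      matD_add (hH.mul hQ) (hH.mul hQ).transpose hU hp, matD_transpose, matD_mul hH hQ hU hp]
  rw [e1, hu p hp, hv p hp] at e2
  have e3 := sub_eq_zero.2 e2
  rw [← e3]
  simp only [curvature, Matrix.transpose_add, Matrix.transpose_sub, Matrix.transpose_mul,
    hsymm p hp, Matrix.transpose_transpose]
  noncomm_ring

-- Any Banach algebra norm on matrices serves to apply the Frobenius theorem.
attribute [local instance] Matrix.linftyOpNormedRing Matrix.linftyOpNormedAlgebra

/-- The Frobenius theorem for frames: a flat connection has a local frame with prescribed value. -/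
theorem exists_frame_of_curvature_eq_zero {P Q : ℝ × ℝ → Matrix (Fin n) (Fin n) ℝ} (hU : IsOpen U)
    (hP : MatSmoothOn U P) (hQ : MatSmoothOn U Q) (hflat : ∀ p ∈ U, curvature P Q p = 0)
    {p₀ : ℝ × ℝ} (hp₀ : p₀ ∈ U) (W₀ : Matrix (Fin n) (Fin n) ℝ) :
    ∃ ε > 0, ball p₀ ε ⊆ U ∧ ∃ W : ℝ × ℝ → Matrix (Fin n) (Fin n) ℝ, W p₀ = W₀ ∧
      MatSmoothOn (ball p₀ ε) W ∧ (∀ p ∈ ball p₀ ε, matD (1, 0) W p = W p * P p) ∧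
      ∀ p ∈ ball p₀ ε, matD (0, 1) W p = W p * Q p := by
  -- the entries are continuous linear functions of the matrix, and conversely
  let entry : Fin n → Fin n → (Matrix (Fin n) (Fin n) ℝ →L[ℝ] ℝ) := fun i j =>
    LinearMap.toContinuousLinearMap (Matrix.entryLinearMap ℝ ℝ i j)
  have hsmooth : ∀ {M : ℝ × ℝ → Matrix (Fin n) (Fin n) ℝ}, MatSmoothOn U M →
      ContDiffOn ℝ ∞ M U := by
    intro M hM
    have : M = fun p => ∑ i, ∑ j, M p i j • Matrix.single i j (1 : ℝ) := by
      funext p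
      conv_lhs => rw [Matrix.matrix_eq_sum_single (M p)]
      simp [Matrix.smul_single]
    rw [this]
    exact ContDiffOn.sum fun i _ => ContDiffOn.sum fun j _ =>
      ContDiffOn.smul (hM i j) contDiffOn_const
  have hD : ∀ {M : ℝ × ℝ → Matrix (Fin n) (Fin n) ℝ} {p : ℝ × ℝ} (ξ : ℝ × ℝ),
      DifferentiableAt ℝ M p → matD ξ M p = fderiv ℝ M p ξ := by
    intro M p ξ hM
    ext i j
    have h := ((entry i j).hasFDerivAt.comp p hM.hasFDerivAt).fderiv
    have h' : fderiv ℝ (fun q => M q i j) p = _ := h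
    simp only [matD, Matrix.of_apply, h']
    rfl
  have hdiff : ∀ {M : ℝ × ℝ → Matrix (Fin n) (Fin n) ℝ}, MatSmoothOn U M → ∀ p ∈ U,
      DifferentiableAt ℝ M p := fun hM p hp =>
    ((hsmooth hM).contDiffAt (hU.mem_nhds hp)).differentiableAt (by simp)
  obtain ⟨ε, hε, hsub, W, hW₀, hWs, hW⟩ := exists_solution_of_flat hU (hsmooth hP) (hsmooth hQ)
    (fun p hp => by
      have h := hflat p hp
      rw [curvature, sub_eq_zero, sub_add_eq_add_sub, sub_eq_iff_eq_add, add_comm (P p * Q p),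
        hD _ (hdiff hP p hp), hD _ (hdiff hQ p hp)] at h
      exact h) hp₀ W₀
  refine ⟨ε, hε, hsub, W, hW₀, fun i j => ?_, fun p hp => ?_, fun p hp => ?_⟩
  · exact (entry i j).contDiff.comp_contDiffOn hWs
  · have h := congrArg (fun L => L (1, 0)) (hW p hp).fderiv
    simp only [add_apply, ContinuousLinearMap.smulRight_apply,
      ContinuousLinearMap.coe_fst', ContinuousLinearMap.coe_snd', one_smul, zero_smul, add_zero] at h
    exact (hD _ (hW p hp).differentiableAt).trans h
  · have h := congrArg (fun L => L (0, 1)) (hW p hp).fderiv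
    simp only [add_apply, ContinuousLinearMap.smulRight_apply,
      ContinuousLinearMap.coe_fst', ContinuousLinearMap.coe_snd', one_smul, zero_smul, zero_add] at h
    exact (hD _ (hW p hp).differentiableAt).trans h

end Connection

/-! ### The connection of a moving base -/

/-- The Gram matrix of a frame `(w₁ w₂ n)` whose first two columns have Gram matrix
`(E F; F G)` and whose third column is a unit normal. -/
def frameMetric (E F G : ℝ × ℝ → ℝ) (p : ℝ × ℝ) : Matrix (Fin 3) (Fin 3) ℝ :=
  !![E p, F p, 0; F p, G p, 0; 0, 0, 1]

/-- The inverse of `frameMetric E F G`, where `EG - F² ≠ 0`. -/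
def frameMetricInv (E F G : ℝ × ℝ → ℝ) (p : ℝ × ℝ) : Matrix (Fin 3) (Fin 3) ℝ :=
  !![G p / (E p * G p - F p ^ 2), -F p / (E p * G p - F p ^ 2), 0;
     -F p / (E p * G p - F p ^ 2), E p / (E p * G p - F p ^ 2), 0; 0, 0, 1]

/-- The matrix `Wᵀ W_ξ` of inner products of the columns of a frame `W = (w₁ w₂ n)` with their
derivatives in the direction `ξ`. Its symmetric part is half the derivative of the Gram matrix; the
rest consists of `a = (⟪w₂, ∂w₁⟫ - ⟪w₁, ∂w₂⟫) / 2` and of `b = ⟪n, ∂w₁⟫`, `c = ⟪n, ∂w₂⟫`. -/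
def connForm (ξ : ℝ × ℝ) (E F G a b c : ℝ × ℝ → ℝ) (p : ℝ × ℝ) : Matrix (Fin 3) (Fin 3) ℝ :=
  !![fderiv ℝ E p ξ / 2, fderiv ℝ F p ξ / 2 - a p, -b p;
     fderiv ℝ F p ξ / 2 + a p, fderiv ℝ G p ξ / 2, -c p;
     b p, c p, 0]

/-- The connection matrix `W⁻¹ W_ξ` of a frame `W` with the data of `connForm`. -/
def conn (ξ : ℝ × ℝ) (E F G a b c : ℝ × ℝ → ℝ) (p : ℝ × ℝ) : Matrix (Fin 3) (Fin 3) ℝ :=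
  frameMetricInv E F G p * connForm ξ E F G a b c p

/-- The change of frame `diag(Λᵀ, 1)` from `(w₁ w₂ n)` to `(x_u x_v n)`. -/
def frameChange (L : ℝ × ℝ → Matrix (Fin 2) (Fin 2) ℝ) (p : ℝ × ℝ) : Matrix (Fin 3) (Fin 3) ℝ :=
  !![L p 0 0, L p 1 0, 0; L p 0 1, L p 1 1, 0; 0, 0, 1]

/-- The part `∂Λ₍₁₎ A Λ₍₂₎ᵀ - Λ₍₁₎ A ∂Λ₍₂₎ᵀ` of the compatibility functions. -/
def twist (ξ : ℝ × ℝ) (L A : ℝ × ℝ → Matrix (Fin 2) (Fin 2) ℝ) (p : ℝ × ℝ) : ℝ :=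
  matD ξ L p 0 ⬝ᵥ (A p *ᵥ L p 1) - L p 0 ⬝ᵥ (A p *ᵥ matD ξ L p 1)

section Algebra

variable {U : Set (ℝ × ℝ)} {p : ℝ × ℝ} {E F G a b c : ℝ × ℝ → ℝ}

theorem frameMetric_mul_inv (h : E p * G p - F p ^ 2 ≠ 0) :
    frameMetric E F G p * frameMetricInv E F G p = 1 := by
  ext i j
  fin_cases i <;> fin_cases j <;>
    simp [frameMetric, frameMetricInv, Matrix.mul_apply, Fin.sum_univ_three] <;> field_simp <;> ring

theorem frameMetricInv_mul (h : E p * G p - F p ^ 2 ≠ 0) :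
    frameMetricInv E F G p * frameMetric E F G p = 1 :=
  mul_eq_one_comm.1 (frameMetric_mul_inv h)

theorem frameMetric_transpose : (frameMetric E F G p)ᵀ = frameMetric E F G p := by
  ext i j
  fin_cases i <;> fin_cases j <;> simp [frameMetric]

theorem frameMetricInv_transpose : (frameMetricInv E F G p)ᵀ = frameMetricInv E F G p := by
  ext i j
  fin_cases i <;> fin_cases j <;> simp [frameMetricInv]

theorem frameMetric_mul_conn (ξ : ℝ × ℝ) (h : E p * G p - F p ^ 2 ≠ 0) :
    frameMetric E F G p * conn ξ E F G a b c p = connForm ξ E F G a b c p := by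
  rw [conn, ← mul_assoc, frameMetric_mul_inv h, one_mul]

theorem matD_frameMetric (ξ : ℝ × ℝ) :
    matD ξ (frameMetric E F G) p
      = connForm ξ E F G a b c p + (connForm ξ E F G a b c p)ᵀ := by
  ext i j
  fin_cases i <;> fin_cases j <;> simp [frameMetric, matD, connForm]

theorem smoothOn_frameMetric (hE : SmoothOn U E) (hF : SmoothOn U F) (hG : SmoothOn U G) :
    MatSmoothOn U (frameMetric E F G) := by
  intro i j
  fin_cases i <;> fin_cases j <;> simp [frameMetric] <;>
    first | assumption | exact contDiffOn_const

theorem smoothOn_frameMetricInv (hE : SmoothOn U E) (hF : SmoothOn U F) (hG : SmoothOn U G)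
    (h : ∀ p ∈ U, E p * G p - F p ^ 2 ≠ 0) : MatSmoothOn U (frameMetricInv E F G) := by
  have hd : ContDiffOn ℝ ∞ (fun p => E p * G p - F p ^ 2) U :=
    (ContDiffOn.mul hE hG).sub (ContDiffOn.pow hF 2)
  intro i j
  fin_cases i <;> fin_cases j <;> simp [frameMetricInv] <;>
    first
    | exact ContDiffOn.div hG hd h
    | exact ContDiffOn.div (ContDiffOn.neg hF) hd h
    | exact ContDiffOn.div hE hd h
    | exact contDiffOn_const

theorem smoothOn_connForm (hU : IsOpen U) (ξ : ℝ × ℝ) (hE : SmoothOn U E) (hF : SmoothOn U F)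
    (hG : SmoothOn U G) (ha : SmoothOn U a) (hb : SmoothOn U b) (hc : SmoothOn U c) :
    MatSmoothOn U (connForm ξ E F G a b c) := by
  have hE' : ContDiffOn ℝ ∞ (fun p => fderiv ℝ E p ξ / 2) U :=
    ContDiffOn.div_const (hE.fderiv_apply hU ξ) 2
  have hF' : ContDiffOn ℝ ∞ (fun p => fderiv ℝ F p ξ / 2) U :=
    ContDiffOn.div_const (hF.fderiv_apply hU ξ) 2
  have hG' : ContDiffOn ℝ ∞ (fun p => fderiv ℝ G p ξ / 2) U :=
    ContDiffOn.div_const (hG.fderiv_apply hU ξ) 2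
  intro i j
  fin_cases i <;> fin_cases j <;> simp [connForm] <;>
    first
    | assumption
    | exact hF'.sub ha
    | exact hF'.add ha
    | exact ContDiffOn.neg hb
    | exact ContDiffOn.neg hc
    | exact contDiffOn_const

theorem smoothOn_conn (hU : IsOpen U) (ξ : ℝ × ℝ) (hE : SmoothOn U E) (hF : SmoothOn U F)
    (hG : SmoothOn U G) (h : ∀ p ∈ U, E p * G p - F p ^ 2 ≠ 0) (ha : SmoothOn U a)
    (hb : SmoothOn U b) (hc : SmoothOn U c) : MatSmoothOn U (conn ξ E F G a b c) :=
  (smoothOn_frameMetricInv hE hF hG h).mul (smoothOn_connForm hU ξ hE hF hG ha hb hc)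

theorem smoothOn_frameChange {L : ℝ × ℝ → Matrix (Fin 2) (Fin 2) ℝ} (hL : MatSmoothOn U L) :
    MatSmoothOn U (frameChange L) := by
  intro i j
  fin_cases i <;> fin_cases j <;> simp [frameChange] <;>
    first | exact hL _ _ | exact contDiffOn_const

theorem det_frameChange (L : ℝ × ℝ → Matrix (Fin 2) (Fin 2) ℝ) :
    (frameChange L p).det = (L p).det := by
  simp [frameChange, Matrix.det_fin_three, Matrix.det_fin_two]
  ring

/-- `∂(H⁻¹) = -(P H⁻¹ + H⁻¹ Pᵀ)` for the connection matrix `P` of a metric `H`. -/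
theorem conn_mul_inv_add (hU : IsOpen U) (hp : p ∈ U) (ξ : ℝ × ℝ) (hE : SmoothOn U E)
    (hF : SmoothOn U F) (hG : SmoothOn U G) (h : ∀ p ∈ U, E p * G p - F p ^ 2 ≠ 0) :
    conn ξ E F G a b c p * frameMetricInv E F G p + matD ξ (frameMetricInv E F G) p
      + frameMetricInv E F G p * (conn ξ E F G a b c p)ᵀ = 0 := by
  have hH := smoothOn_frameMetric hE hF hG
  have hK := smoothOn_frameMetricInv hE hF hG h
  have h1 : matD ξ (frameMetric E F G) p * frameMetricInv E F G p
      + frameMetric E F G p * matD ξ (frameMetricInv E F G) p = 0 := by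
    rw [← matD_mul hH hK hU hp, matD_congr hU hp fun q hq => frameMetric_mul_inv (h q hq)]
    exact matD_const _ _
  have h2 : matD ξ (frameMetricInv E F G) p
      = -(frameMetricInv E F G p * matD ξ (frameMetric E F G) p * frameMetricInv E F G p) := by
    have := congrArg (frameMetricInv E F G p * ·) h1
    simp only [mul_add, ← mul_assoc, frameMetricInv_mul (h p hp), one_mul, mul_zero] at this
    exact eq_neg_of_add_eq_zero_right this
  rw [h2, matD_frameMetric (a := a) (b := b) (c := c), conn, Matrix.transpose_mul,
    frameMetricInv_transpose]
  noncomm_ring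

/-- Two frames with the same Gram matrix and the same connection differ by a constant. -/
theorem matD_mul_inv_mul_transpose (hU : IsOpen U) (hp : p ∈ U) (ξ : ℝ × ℝ) (hE : SmoothOn U E)
    (hF : SmoothOn U F) (hG : SmoothOn U G) (h : ∀ p ∈ U, E p * G p - F p ^ 2 ≠ 0)
    {W W' : ℝ × ℝ → Matrix (Fin 3) (Fin 3) ℝ} (hW : MatSmoothOn U W) (hW' : MatSmoothOn U W')
    (hd : matD ξ W p = W p * conn ξ E F G a b c p)
    (hd' : matD ξ W' p = W' p * conn ξ E F G a b c p) :
    matD ξ (fun q => W' q * frameMetricInv E F G q * (W q)ᵀ) p = 0 := by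
  have hK := smoothOn_frameMetricInv hE hF hG h
  rw [matD_mul (hW'.mul hK) hW.transpose hU hp, matD_mul hW' hK hU hp, matD_transpose, hd, hd',
    Matrix.transpose_mul]
  have h3 := conn_mul_inv_add (a := a) (b := b) (c := c) hU hp ξ hE hF hG h
  calc _ = W' p * (conn ξ E F G a b c p * frameMetricInv E F G p
      + matD ξ (frameMetricInv E F G) p
      + frameMetricInv E F G p * (conn ξ E F G a b c p)ᵀ) * (W p)ᵀ := by noncomm_ring
    _ = 0 := by rw [h3]; simp

/-- How `connForm` changes from the frame `(w₁ w₂ n)` to the frame `(x_u x_v n)`. -/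
theorem connForm_frameChange (hU : IsOpen U) (hp : p ∈ U) (ξ : ℝ × ℝ) {EΩ FΩ GΩ : ℝ × ℝ → ℝ}
    {L : ℝ × ℝ → Matrix (Fin 2) (Fin 2) ℝ} (hEΩ : SmoothOn U EΩ)
    (hFΩ : SmoothOn U FΩ) (hGΩ : SmoothOn U GΩ) (hL : MatSmoothOn U L)
    (hI : ∀ p ∈ U, symMat E F G p = L p * symMat EΩ FΩ GΩ p * (L p)ᵀ) {b' c' k : ℝ × ℝ → ℝ}
    (hb : b' p = L p 0 0 * b p + L p 0 1 * c p) (hc : c' p = L p 1 0 * b p + L p 1 1 * c p)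
    (hk : k p = a p * (L p).det + twist ξ L (symMat EΩ FΩ GΩ) p / 2) :
    (frameChange L p)ᵀ * connForm ξ EΩ FΩ GΩ a b c p * frameChange L p
      + (frameChange L p)ᵀ * frameMetric EΩ FΩ GΩ p * matD ξ (frameChange L) p
      = connForm ξ E F G k b' c' p := by
  have hA : MatSmoothOn U (symMat EΩ FΩ GΩ) := by
    intro i j
    fin_cases i <;> fin_cases j <;> simpa [symMat]
  have hD : matD ξ (symMat E F G) p
      = (matD ξ L p * symMat EΩ FΩ GΩ p + L p * matD ξ (symMat EΩ FΩ GΩ) p) * (L p)ᵀ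
        + L p * symMat EΩ FΩ GΩ p * (matD ξ L p)ᵀ := by
    rw [matD_congr hU hp hI, matD_mul (hL.mul hA) hL.transpose hU hp, matD_mul hL hA hU hp,
      matD_transpose]
  have hDA : ∀ E F G : ℝ × ℝ → ℝ, matD ξ (symMat E F G) p
      = !![fderiv ℝ E p ξ, fderiv ℝ F p ξ; fderiv ℝ F p ξ, fderiv ℝ G p ξ] := by
    intro E F G
    ext i j
    fin_cases i <;> fin_cases j <;> simp [matD, symMat]
  have hDT : matD ξ (frameChange L) p = !![matD ξ L p 0 0, matD ξ L p 1 0, 0;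
      matD ξ L p 0 1, matD ξ L p 1 1, 0; 0, 0, 0] := by
    ext i j
    fin_cases i <;> fin_cases j <;> simp [matD, frameChange]
  rw [hDA, hDA] at hD
  have h00 := congrFun (congrFun hD 0) 0
  have h01 := congrFun (congrFun hD 0) 1
  have h11 := congrFun (congrFun hD 1) 1
  rw [hDT]
  simp only [twist, Matrix.det_fin_two] at hk
  generalize matD ξ L p = M at *
  simp [Matrix.mul_apply, Fin.sum_univ_two, symMat] at h00 h01 h11
  simp [dotProduct, Matrix.mulVec, Fin.sum_univ_two, symMat] at hk
  ext i j
  fin_cases i <;> fin_cases j <;>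
    simp [Matrix.mul_apply, Fin.sum_univ_three, frameChange, connForm, frameMetric, hb, hc, hk,
      h00, h01, h11] <;> ring

theorem frameMetric_frameChange {EΩ FΩ GΩ : ℝ × ℝ → ℝ} {L : ℝ × ℝ → Matrix (Fin 2) (Fin 2) ℝ}
    (hI : symMat E F G p = L p * symMat EΩ FΩ GΩ p * (L p)ᵀ) :
    (frameChange L p)ᵀ * frameMetric EΩ FΩ GΩ p * frameChange L p = frameMetric E F G p := by
  have h00 := congrFun (congrFun hI 0) 0
  have h01 := congrFun (congrFun hI 0) 1
  have h11 := congrFun (congrFun hI 1) 1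
  simp [Matrix.mul_apply, Fin.sum_univ_two, symMat] at h00 h01 h11
  ext i j
  fin_cases i <;> fin_cases j <;>
    simp [Matrix.mul_apply, Fin.sum_univ_three, frameChange, frameMetric, h00, h01, h11]
  all_goals ring

/-- On the regular set the connections of `(w₁ w₂ n)` and `(x_u x_v n)` are gauge equivalent. -/
theorem frameChange_mul_conn (hU : IsOpen U) (hp : p ∈ U) (ξ : ℝ × ℝ) {EΩ FΩ GΩ : ℝ × ℝ → ℝ}
    {L : ℝ × ℝ → Matrix (Fin 2) (Fin 2) ℝ} (hEΩ : SmoothOn U EΩ)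
    (hFΩ : SmoothOn U FΩ) (hGΩ : SmoothOn U GΩ) (hL : MatSmoothOn U L)
    (hI : ∀ p ∈ U, symMat E F G p = L p * symMat EΩ FΩ GΩ p * (L p)ᵀ) {b' c' k : ℝ × ℝ → ℝ}
    (hb : b' p = L p 0 0 * b p + L p 0 1 * c p) (hc : c' p = L p 1 0 * b p + L p 1 1 * c p)
    (hk : k p = a p * (L p).det + twist ξ L (symMat EΩ FΩ GΩ) p / 2)
    (hΩ : EΩ p * GΩ p - FΩ p ^ 2 ≠ 0) (h : E p * G p - F p ^ 2 ≠ 0) (hdet : (L p).det ≠ 0) :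
    frameChange L p * conn ξ E F G k b' c' p
      = conn ξ EΩ FΩ GΩ a b c p * frameChange L p + matD ξ (frameChange L) p := by
  have hmetric := frameMetric_frameChange (hI p hp)
  have hunit : IsUnit ((frameChange L p)ᵀ * frameMetric EΩ FΩ GΩ p) := by
    refine IsUnit.mul ?_ (IsUnit.of_mul_eq_one _ (frameMetric_mul_inv hΩ))
    rw [Matrix.isUnit_iff_isUnit_det, Matrix.det_transpose, det_frameChange]
    exact hdet.isUnit
  refine hunit.mul_left_cancel ?_
  calc _ = (frameChange L p)ᵀ * frameMetric EΩ FΩ GΩ p * frameChange L p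
        * conn ξ E F G k b' c' p := by simp only [mul_assoc]
    _ = (frameChange L p)ᵀ * (frameMetric EΩ FΩ GΩ p * conn ξ EΩ FΩ GΩ a b c p)
        * frameChange L p
        + (frameChange L p)ᵀ * frameMetric EΩ FΩ GΩ p * matD ξ (frameChange L) p := by
      rw [hmetric, frameMetric_mul_conn ξ h, frameMetric_mul_conn ξ hΩ,
        connForm_frameChange hU hp ξ hEΩ hFΩ hGΩ hL hI hb hc hk]
    _ = _ := by simp only [mul_add, mul_assoc]

end Algebra

/-! ### Flatness from the Gauss and Mainardi–Codazzi equations -/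

section Flatness

variable {U : Set (ℝ × ℝ)} {p : ℝ × ℝ} {E F G e f g : ℝ × ℝ → ℝ}

/-- The connection of `(x_u x_v n)` in the direction `u`: the Gauss and Weingarten formulas. -/
def classicalConnU (E F G e f : ℝ × ℝ → ℝ) : ℝ × ℝ → Matrix (Fin 3) (Fin 3) ℝ :=
  conn (1, 0) E F G (fun p => (du F p - dv E p) / 2) e f

/-- The connection of `(x_u x_v n)` in the direction `v`: the Gauss and Weingarten formulas. -/
def classicalConnV (E F G f g : ℝ × ℝ → ℝ) : ℝ × ℝ → Matrix (Fin 3) (Fin 3) ℝ :=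
  conn (0, 1) E F G (fun p => (du G p - dv F p) / 2) f g

theorem classicalConnU_eq (E F G e f : ℝ × ℝ → ℝ) (p : ℝ × ℝ) :
    classicalConnU E F G e f p = !![christoffel₁ E F G p 0 0, christoffel₁ E F G p 1 0,
      (F p * f p - G p * e p) / (E p * G p - F p ^ 2);
      christoffel₁ E F G p 0 1, christoffel₁ E F G p 1 1,
      (F p * e p - E p * f p) / (E p * G p - F p ^ 2); e p, f p, 0] := by
  ext i j
  fin_cases i <;> fin_cases j <;>
    simp [classicalConnU, conn, connForm, frameMetricInv, christoffel₁, symMat, du, dv,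
      Matrix.mul_apply, Fin.sum_univ_three, Fin.sum_univ_two, Matrix.inv_def, Matrix.det_fin_two,
      Matrix.adjugate_fin_two] <;> ring

theorem classicalConnV_eq (E F G f g : ℝ × ℝ → ℝ) (p : ℝ × ℝ) :
    classicalConnV E F G f g p = !![christoffel₂ E F G p 0 0, christoffel₂ E F G p 1 0,
      (F p * g p - G p * f p) / (E p * G p - F p ^ 2);
      christoffel₂ E F G p 0 1, christoffel₂ E F G p 1 1,
      (F p * f p - E p * g p) / (E p * G p - F p ^ 2); f p, g p, 0] := by
  ext i j
  fin_cases i <;> fin_cases j <;>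
    simp [classicalConnV, conn, connForm, frameMetricInv, christoffel₂, symMat, du, dv,
      Matrix.mul_apply, Fin.sum_univ_three, Fin.sum_univ_two, Matrix.inv_def, Matrix.det_fin_two,
      Matrix.adjugate_fin_two] <;> ring

theorem curvature_apply {n : ℕ} (P Q : ℝ × ℝ → Matrix (Fin n) (Fin n) ℝ) (i j : Fin n) :
    curvature P Q p i j = fderiv ℝ (fun q => P q i j) p (0, 1)
      - fderiv ℝ (fun q => Q q i j) p (1, 0) + ∑ k, Q p i k * P p k j - ∑ k, P p i k * Q p k j := by
  simp only [curvature, Matrix.sub_apply, Matrix.add_apply, Matrix.mul_apply]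
  rfl

theorem christoffel_symm (E F G : ℝ × ℝ → ℝ) (p : ℝ × ℝ) (j : Fin 2) :
    christoffel₁ E F G p 1 j = christoffel₂ E F G p 0 j := by
  simp [christoffel₁, christoffel₂, Matrix.mul_apply]

/-- On the regular set, the Gauss and Mainardi–Codazzi equations say that the classical connection
is flat: they are three entries of the curvature, and the others follow since the curvature is skew
with respect to the metric. -/
theorem curvature_classicalConn_eq_zero (hU : IsOpen U) (hp : p ∈ U) (hE : SmoothOn U E)
    (hF : SmoothOn U F) (hG : SmoothOn U G) (he : SmoothOn U e) (hf : SmoothOn U f)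
    (hg : SmoothOn U g) (h : ∀ p ∈ U, E p * G p - F p ^ 2 ≠ 0) (hE0 : E p ≠ 0)
    (hGauss : GaussEq E F G e f g p) (hMC : MainardiCodazziEq E F G e f g p) :
    curvature (classicalConnU E F G e f) (classicalConnV E F G f g) p = 0 := by
  have hs1 : SmoothOn U fun p => (du F p - dv E p) / 2 :=
    ContDiffOn.div_const (ContDiffOn.sub (hF.fderiv_apply hU _) (hE.fderiv_apply hU _)) 2
  have hs2 : SmoothOn U fun p => (du G p - dv F p) / 2 :=
    ContDiffOn.div_const (ContDiffOn.sub (hG.fderiv_apply hU _) (hF.fderiv_apply hU _)) 2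
  have hskew := metric_mul_curvature_add_transpose hU (smoothOn_frameMetric hE hF hG)
    (P := classicalConnU E F G e f) (Q := classicalConnV E F G f g)
    (smoothOn_conn hU _ hE hF hG h hs1 he hf) (smoothOn_conn hU _ hE hF hG h hs2 hf hg)
    (fun q _ => frameMetric_transpose)
    (fun q hq => by rw [classicalConnU, frameMetric_mul_conn _ (h q hq)]; exact matD_frameMetric _)
    (fun q hq => by rw [classicalConnV, frameMetric_mul_conn _ (h q hq)]; exact matD_frameMetric _)
    hp
  have hD := h p hp
  have h20 : curvature (classicalConnU E F G e f) (classicalConnV E F G f g) p 2 0 = 0 := by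
    have := hMC.1
    simp only [du, dv] at this
    simp [curvature_apply, classicalConnU_eq, classicalConnV_eq, Fin.sum_univ_three,
      christoffel_symm]
    linear_combination this
  have h21 : curvature (classicalConnU E F G e f) (classicalConnV E F G f g) p 2 1 = 0 := by
    have := hMC.2
    simp only [du, dv] at this
    simp [curvature_apply, classicalConnU_eq, classicalConnV_eq, Fin.sum_univ_three,
      christoffel_symm]
    linear_combination this
  have h10 : curvature (classicalConnU E F G e f) (classicalConnV E F G f g) p 1 0 = 0 := by
    have := hGauss
    simp only [GaussEq, du, dv, gaussCurvature] at this
    simp [curvature_apply, classicalConnU_eq, classicalConnV_eq, Fin.sum_univ_three,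
      christoffel_symm]
    have hK : (F p * f p - E p * g p) / (E p * G p - F p ^ 2) * e p
        - (F p * e p - E p * f p) / (E p * G p - F p ^ 2) * f p
        = -(E p * ((e p * g p - f p ^ 2) / (E p * G p - F p ^ 2))) := by
      field_simp
      ring
    linear_combination hK - this
  generalize curvature (classicalConnU E F G e f) (classicalConnV E F G f g) p = R at *
  have entry : ∀ i j, _ := fun i j => congrFun (congrFun hskew i) j
  have s00 := entry 0 0
  have s01 := entry 0 1
  have s02 := entry 0 2
  have s11 := entry 1 1
  have s12 := entry 1 2
  have s22 := entry 2 2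
  simp only [Matrix.add_apply, Matrix.transpose_apply, Matrix.mul_apply, Fin.sum_univ_three,
    Matrix.zero_apply] at s00 s01 s02 s11 s12 s22
  simp [frameMetric, h20, h21, h10] at s00 s01 s02 s11 s12 s22
  have r00 : R 0 0 = 0 := s00.resolve_left hE0
  rw [r00] at s01
  have r01 : R 0 1 = 0 := by
    have : (E p * G p - F p ^ 2) * R 0 1 = 0 := by
      linear_combination G p * s01 - F p * s11
    exact (mul_eq_zero.1 this).resolve_left hD
  have r11 : R 1 1 = 0 := by
    have : (E p * G p - F p ^ 2) * R 1 1 = 0 := by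
      linear_combination E p * s11 - F p * s01
    exact (mul_eq_zero.1 this).resolve_left hD
  have r02 : R 0 2 = 0 := by
    have : (E p * G p - F p ^ 2) * R 0 2 = 0 := by linear_combination G p * s02 - F p * s12
    exact (mul_eq_zero.1 this).resolve_left hD
  have r12 : R 1 2 = 0 := by
    have : (E p * G p - F p ^ 2) * R 1 2 = 0 := by linear_combination E p * s12 - F p * s02
    exact (mul_eq_zero.1 this).resolve_left hD
  ext i j
  fin_cases i <;> fin_cases j <;> assumption

end Flatness

/-! ### Frames and the frontals that they realize -/

/-- A frame `W = (w₁ w₂ n)` on `V`, positively oriented, whose third column is a unit normal of the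
first two and whose derivatives are given by the connection with the data `(aU, b₁, c₁)` in the
direction `u` and `(aV, b₂, c₂)` in the direction `v`. -/
structure IsFrame (V : Set (ℝ × ℝ)) (E F G aU b₁ c₁ aV b₂ c₂ : ℝ × ℝ → ℝ)
    (W : ℝ × ℝ → Matrix (Fin 3) (Fin 3) ℝ) : Prop where
  smooth : MatSmoothOn V W
  gram : ∀ p ∈ V, (W p)ᵀ * W p = frameMetric E F G p
  det_pos : ∀ p ∈ V, 0 < (W p).det
  eqU : ∀ p ∈ V, matD (1, 0) W p = W p * conn (1, 0) E F G aU b₁ c₁ p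
  eqV : ∀ p ∈ V, matD (0, 1) W p = W p * conn (0, 1) E F G aV b₂ c₂ p

/-- The moving base formed by the first two columns of a frame. -/
def frameBase (W : ℝ × ℝ → Matrix (Fin 3) (Fin 3) ℝ) (p : ℝ × ℝ) : Matrix (Fin 3) (Fin 2) ℝ :=
  Matrix.of fun i j => W p i j.castSucc

/-- The frame formed by a moving base and its induced unit normal. -/
def baseFrame (M : ℝ × ℝ → Matrix (Fin 3) (Fin 2) ℝ) (p : ℝ × ℝ) : Matrix (Fin 3) (Fin 3) ℝ :=
  Matrix.of fun i j => ![M p i 0, M p i 1, unitNormal M p i] j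

section Frames

variable {V : Set (ℝ × ℝ)} {p : ℝ × ℝ} {E F G aU b₁ c₁ aV b₂ c₂ : ℝ × ℝ → ℝ}
  {W : ℝ × ℝ → Matrix (Fin 3) (Fin 3) ℝ}

theorem mul_inv_mul_transpose_eq_one {M : Matrix (Fin 3) (Fin 3) ℝ}
    (h : E p * G p - F p ^ 2 ≠ 0) (hM : Mᵀ * M = frameMetric E F G p) :
    M * frameMetricInv E F G p * Mᵀ = 1 := by
  rw [mul_assoc]
  refine mul_eq_one_comm.1 ?_
  rw [mul_assoc, hM, frameMetricInv_mul h]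

theorem transpose_mul_self_of_mul_inv {M : Matrix (Fin 3) (Fin 3) ℝ}
    (h : E p * G p - F p ^ 2 ≠ 0) (hM : M * frameMetricInv E F G p * Mᵀ = 1) :
    Mᵀ * M = frameMetric E F G p := by
  rw [mul_assoc] at hM
  have h1 := mul_eq_one_comm.1 hM
  calc Mᵀ * M = frameMetric E F G p * frameMetricInv E F G p * (Mᵀ * M) := by
        rw [frameMetric_mul_inv h, one_mul]
    _ = frameMetric E F G p * (frameMetricInv E F G p * Mᵀ * M) := by simp only [mul_assoc]
    _ = _ := by rw [h1, mul_one]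

/-- A positively oriented matrix whose third column is a unit normal of the first two: that column is
the normalized cross product of the others. -/
theorem unitNormal_frameBase (hgram : (W p)ᵀ * W p = frameMetric E F G p) (hdet : 0 < (W p).det)
    (i : Fin 3) : unitNormal (frameBase W) p i = W p i 2 := by
  have hc : (W p)ᵀ *ᵥ crossCols (frameBase W) p = (W p)ᵀ *ᵥ ((W p).det • fun i => W p i 2) := by
    have g02 := congrFun (congrFun hgram 0) 2
    have g12 := congrFun (congrFun hgram 1) 2
    have g22 := congrFun (congrFun hgram 2) 2
    simp [Matrix.mul_apply, Fin.sum_univ_three, frameMetric] at g02 g12 g22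
    have hrhs : (W p)ᵀ *ᵥ ((W p).det • fun i => W p i 2) = ![0, 0, (W p).det] := by
      rw [Matrix.mulVec_smul]
      ext j
      fin_cases j <;> simp [Matrix.mulVec, dotProduct, Fin.sum_univ_three, g02, g12, g22]
    rw [hrhs]
    ext j
    fin_cases j <;>
      simp [Matrix.mulVec, dotProduct, Fin.sum_univ_three, crossCols, cross_apply, frameBase,
        Matrix.det_fin_three] <;> ring
  have hinj : Function.Injective ((W p)ᵀ.mulVec) := by
    refine Matrix.mulVec_injective_of_isUnit ?_
    rw [Matrix.isUnit_iff_isUnit_det, Matrix.det_transpose]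
    exact hdet.ne'.isUnit
  have hcross := hinj hc
  have g22 := congrFun (congrFun hgram 2) 2
  simp [Matrix.mul_apply, Fin.sum_univ_three, frameMetric] at g22
  have hsq : crossCols (frameBase W) p ⬝ᵥ crossCols (frameBase W) p = (W p).det ^ 2 := by
    rw [hcross]
    simp only [dotProduct, Pi.smul_apply, smul_eq_mul, Fin.sum_univ_three]
    linear_combination (W p).det ^ 2 * g22
  rw [unitNormal, hsq, Real.sqrt_sq hdet.le, hcross]
  simp [hdet.ne']

theorem crossCols_dot_self {M : ℝ × ℝ → Matrix (Fin 3) (Fin 2) ℝ}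
    (h : baseFirstForm M p = symMat E F G p) :
    crossCols M p ⬝ᵥ crossCols M p = E p * G p - F p ^ 2 := by
  have h00 := congrFun (congrFun h 0) 0
  have h01 := congrFun (congrFun h 0) 1
  have h10 := congrFun (congrFun h 1) 0
  have h11 := congrFun (congrFun h 1) 1
  simp only [baseFirstForm, Matrix.mul_apply, Matrix.transpose_apply, symMat] at h00 h01 h10 h11
  rw [crossCols, cross_dot_cross]
  simp only [dotProduct, Matrix.col_apply]
  rw [h00, h01, h10, h11]
  simp
  ring

theorem baseFrame_gram {M : ℝ × ℝ → Matrix (Fin 3) (Fin 2) ℝ}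
    (h : baseFirstForm M p = symMat E F G p) (hD : 0 < E p * G p - F p ^ 2) :
    (baseFrame M p)ᵀ * baseFrame M p = frameMetric E F G p := by
  have hcc := crossCols_dot_self h
  have h00 := congrFun (congrFun h 0) 0
  have h01 := congrFun (congrFun h 0) 1
  have h11 := congrFun (congrFun h 1) 1
  simp [baseFirstForm, Matrix.mul_apply, symMat, Fin.sum_univ_three] at h00 h01 h11
  have hs := Real.sq_sqrt hD.le
  have hs0 := (Real.sqrt_pos.2 hD).ne'
  have n0 : ∑ i, M p i 0 * unitNormal M p i = 0 := by
    have : (M p).col 0 ⬝ᵥ unitNormal M p = 0 := by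
      rw [unitNormal, dotProduct_smul, crossCols, dot_self_cross, smul_zero]
    exact this
  have n1 : ∑ i, M p i 1 * unitNormal M p i = 0 := by
    have : (M p).col 1 ⬝ᵥ unitNormal M p = 0 := by
      rw [unitNormal, dotProduct_smul, crossCols, dot_cross_self, smul_zero]
    exact this
  have n2 : ∑ i, unitNormal M p i * unitNormal M p i = 1 := by
    have : unitNormal M p ⬝ᵥ unitNormal M p = 1 := by
      rw [unitNormal, hcc, smul_dotProduct, dotProduct_smul, hcc, smul_eq_mul, smul_eq_mul]
      field_simp
      exact hs.symm
    exact this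
  simp only [Fin.sum_univ_three] at n0 n1 n2
  ext i j
  fin_cases i <;> fin_cases j <;>
    simp [baseFrame, Matrix.mul_apply, Fin.sum_univ_three, frameMetric]
  all_goals linarith

theorem baseFrame_det_pos {M : ℝ × ℝ → Matrix (Fin 3) (Fin 2) ℝ}
    (h : baseFirstForm M p = symMat E F G p) (hD : 0 < E p * G p - F p ^ 2) :
    0 < (baseFrame M p).det := by
  have hcc := crossCols_dot_self h
  have hdet : (baseFrame M p).det = crossCols M p ⬝ᵥ unitNormal M p := by
    simp [baseFrame, Matrix.det_fin_three, dotProduct, Fin.sum_univ_three, crossCols, cross_apply]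
    ring
  rw [hdet, unitNormal, dotProduct_smul, hcc, smul_eq_mul]
  have := Real.sqrt_pos.2 hD
  positivity

theorem baseFrame_smooth {M : ℝ × ℝ → Matrix (Fin 3) (Fin 2) ℝ} (hM : MatSmoothOn V M)
    (h : ∀ p ∈ V, baseFirstForm M p = symMat E F G p) (hD : ∀ p ∈ V, 0 < E p * G p - F p ^ 2) :
    MatSmoothOn V (baseFrame M) := by
  have hcross : ∀ i, ContDiffOn ℝ ∞ (fun p => crossCols M p i) V := by
    intro i
    fin_cases i <;> simp [crossCols, cross_apply] <;>
      exact (ContDiffOn.mul (hM _ _) (hM _ _)).sub (ContDiffOn.mul (hM _ _) (hM _ _))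
  have hcc : ContDiffOn ℝ ∞ (fun p => crossCols M p ⬝ᵥ crossCols M p) V :=
    ContDiffOn.sum fun i _ => (hcross i).mul (hcross i)
  have hpos : ∀ p ∈ V, 0 < crossCols M p ⬝ᵥ crossCols M p := fun p hp => by
    rw [crossCols_dot_self (h p hp)]; exact hD p hp
  have hn : ∀ i, ContDiffOn ℝ ∞ (fun p => unitNormal M p i) V := fun i =>
    ((hcc.sqrt fun p hp => (hpos p hp).ne').inv fun p hp =>
      (Real.sqrt_pos.2 (hpos p hp)).ne').mul (hcross i)
  intro i j
  fin_cases j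
  · exact hM i 0
  · exact hM i 1
  · exact hn i

theorem IsFrame.dot_normal (h : IsFrame V E F G aU b₁ c₁ aV b₂ c₂ W) (hp : p ∈ V)
    (M : Matrix (Fin 3) (Fin 3) ℝ) (j : Fin 3) :
    ∑ i, W p i 2 * (W p * M) i j = (frameMetric E F G p * M) 2 j := by
  rw [← h.gram p hp, mul_assoc, Matrix.mul_apply (M := (W p)ᵀ)]
  rfl

theorem IsFrame.baseSecondForm_eq (h : IsFrame V E F G aU b₁ c₁ aV b₂ c₂ W) (hV : IsOpen V)
    (hD : ∀ p ∈ V, E p * G p - F p ^ 2 ≠ 0) (hp : p ∈ V) :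
    baseSecondForm (frameBase W) p = !![b₁ p, b₂ p; c₁ p, c₂ p] := by
  have hn : ∀ ξ i, fderiv ℝ (fun q => unitNormal (frameBase W) q i) p ξ = matD ξ W p i 2 := by
    intro ξ i
    have : (fun q => unitNormal (frameBase W) q i) =ᶠ[𝓝 p] fun q => W q i 2 := by
      filter_upwards [hV.mem_nhds hp] with q hq
      exact unitNormal_frameBase (h.gram q hq) (h.det_pos q hq) i
    rw [this.fderiv_eq]
    rfl
  have hu : ((W p)ᵀ * matD (1, 0) W p) = connForm (1, 0) E F G aU b₁ c₁ p := by
    rw [h.eqU p hp, ← mul_assoc, h.gram p hp, frameMetric_mul_conn _ (hD p hp)]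
  have hv : ((W p)ᵀ * matD (0, 1) W p) = connForm (0, 1) E F G aV b₂ c₂ p := by
    rw [h.eqV p hp, ← mul_assoc, h.gram p hp, frameMetric_mul_conn _ (hD p hp)]
  have u0 := congrFun (congrFun hu 0) 2
  have u1 := congrFun (congrFun hu 1) 2
  have v0 := congrFun (congrFun hv 0) 2
  have v1 := congrFun (congrFun hv 1) 2
  simp only [Matrix.mul_apply, Matrix.transpose_apply, Fin.sum_univ_three] at u0 u1 v0 v1
  simp [connForm] at u0 u1 v0 v1
  ext i j
  fin_cases i <;> fin_cases j <;>
    simp [baseSecondForm, jacobian, vecDu, vecDv, du, dv, hn, Matrix.mul_apply,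
      Fin.sum_univ_three, frameBase] <;> linarith

end Frames

/-! ### Compatibility of the prescribed data -/

/-- The compatibility conditions between the fundamental forms of a frontal and the data of a moving
base. The functions `aU` and `aV` stand for `(⟪w₂, ∂w₁⟫ - ⟪w₁, ∂w₂⟫) / 2` in the directions `u` and
`v`; the ideal conditions say that `twistU` and `twistV` have smooth solutions. -/
structure CompatibleData (U : Set (ℝ × ℝ)) (E F G e f g EΩ FΩ GΩ eΩ f₁Ω f₂Ω gΩ : ℝ × ℝ → ℝ)
    (L : ℝ × ℝ → Matrix (Fin 2) (Fin 2) ℝ) (aU aV : ℝ × ℝ → ℝ) : Prop where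
  isOpen : IsOpen U
  smooth_EΩ : SmoothOn U EΩ
  smooth_FΩ : SmoothOn U FΩ
  smooth_GΩ : SmoothOn U GΩ
  smooth_eΩ : SmoothOn U eΩ
  smooth_f₁Ω : SmoothOn U f₁Ω
  smooth_f₂Ω : SmoothOn U f₂Ω
  smooth_gΩ : SmoothOn U gΩ
  smooth_L : MatSmoothOn U L
  smooth_aU : SmoothOn U aU
  smooth_aV : SmoothOn U aV
  pos : ∀ p ∈ U, 0 < EΩ p * GΩ p - FΩ p ^ 2
  first : ∀ p ∈ U, symMat E F G p = L p * symMat EΩ FΩ GΩ p * (L p)ᵀ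
  second : ∀ p ∈ U, symMat e f g p = L p * !![eΩ p, f₁Ω p; f₂Ω p, gΩ p]
  interior_eq : interior {p ∈ U | (L p).det = 0} = ∅
  twistU : ∀ p ∈ U,
    aU p * (L p).det = (du F p - dv E p - twist (1, 0) L (symMat EΩ FΩ GΩ) p) / 2
  twistV : ∀ p ∈ U,
    aV p * (L p).det = (du G p - dv F p - twist (0, 1) L (symMat EΩ FΩ GΩ) p) / 2

namespace CompatibleData

variable {U V : Set (ℝ × ℝ)} {p : ℝ × ℝ} {E F G e f g EΩ FΩ GΩ eΩ f₁Ω f₂Ω gΩ : ℝ × ℝ → ℝ}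
  {L : ℝ × ℝ → Matrix (Fin 2) (Fin 2) ℝ} {aU aV : ℝ × ℝ → ℝ}

theorem smooth_connU (h : CompatibleData U E F G e f g EΩ FΩ GΩ eΩ f₁Ω f₂Ω gΩ L aU aV) :
    MatSmoothOn U (conn (1, 0) EΩ FΩ GΩ aU eΩ f₂Ω) :=
  smoothOn_conn h.isOpen _ h.smooth_EΩ h.smooth_FΩ h.smooth_GΩ (fun p hp => (h.pos p hp).ne')
    h.smooth_aU h.smooth_eΩ h.smooth_f₂Ω

theorem smooth_connV (h : CompatibleData U E F G e f g EΩ FΩ GΩ eΩ f₁Ω f₂Ω gΩ L aU aV) :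
    MatSmoothOn U (conn (0, 1) EΩ FΩ GΩ aV f₁Ω gΩ) :=
  smoothOn_conn h.isOpen _ h.smooth_EΩ h.smooth_FΩ h.smooth_GΩ (fun p hp => (h.pos p hp).ne')
    h.smooth_aV h.smooth_f₁Ω h.smooth_gΩ

theorem second_entries (h : CompatibleData U E F G e f g EΩ FΩ GΩ eΩ f₁Ω f₂Ω gΩ L aU aV)
    (hp : p ∈ U) :
    (e p = L p 0 0 * eΩ p + L p 0 1 * f₂Ω p ∧ f p = L p 1 0 * eΩ p + L p 1 1 * f₂Ω p) ∧
    (f p = L p 0 0 * f₁Ω p + L p 0 1 * gΩ p ∧ g p = L p 1 0 * f₁Ω p + L p 1 1 * gΩ p) := by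
  have hs := h.second p hp
  have h00 := congrFun (congrFun hs 0) 0
  have h01 := congrFun (congrFun hs 0) 1
  have h10 := congrFun (congrFun hs 1) 0
  have h11 := congrFun (congrFun hs 1) 1
  simp [symMat, Matrix.mul_apply, Fin.sum_univ_two] at h00 h01 h10 h11
  exact ⟨⟨h00, h10⟩, h01, h11⟩

theorem det_first (h : CompatibleData U E F G e f g EΩ FΩ GΩ eΩ f₁Ω f₂Ω gΩ L aU aV)
    (hp : p ∈ U) :
    E p * G p - F p ^ 2 = (L p).det ^ 2 * (EΩ p * GΩ p - FΩ p ^ 2) := by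
  have := congrArg Matrix.det (h.first p hp)
  rw [Matrix.det_mul, Matrix.det_mul, Matrix.det_transpose] at this
  simp only [symMat, Matrix.det_fin_two_of] at this
  linear_combination this

theorem gaugeU (h : CompatibleData U E F G e f g EΩ FΩ GΩ eΩ f₁Ω f₂Ω gΩ L aU aV) (hp : p ∈ U)
    (hdet : (L p).det ≠ 0) :
    frameChange L p * classicalConnU E F G e f p
      = conn (1, 0) EΩ FΩ GΩ aU eΩ f₂Ω p * frameChange L p + matD (1, 0) (frameChange L) p := by
  refine frameChange_mul_conn h.isOpen hp _ h.smooth_EΩ h.smooth_FΩ h.smooth_GΩ h.smooth_L h.first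
    (h.second_entries hp).1.1 (h.second_entries hp).1.2 ?_ (h.pos p hp).ne' ?_ hdet
  · linear_combination -h.twistU p hp
  · rw [h.det_first hp]
    exact mul_ne_zero (pow_ne_zero 2 hdet) (h.pos p hp).ne'

theorem gaugeV (h : CompatibleData U E F G e f g EΩ FΩ GΩ eΩ f₁Ω f₂Ω gΩ L aU aV) (hp : p ∈ U)
    (hdet : (L p).det ≠ 0) :
    frameChange L p * classicalConnV E F G f g p
      = conn (0, 1) EΩ FΩ GΩ aV f₁Ω gΩ p * frameChange L p + matD (0, 1) (frameChange L) p := by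
  refine frameChange_mul_conn h.isOpen hp _ h.smooth_EΩ h.smooth_FΩ h.smooth_GΩ h.smooth_L h.first
    (h.second_entries hp).2.1 (h.second_entries hp).2.2 ?_ (h.pos p hp).ne' ?_ hdet
  · linear_combination -h.twistV p hp
  · rw [h.det_first hp]
    exact mul_ne_zero (pow_ne_zero 2 hdet) (h.pos p hp).ne'

/-- The compatibility condition `(x_u)_v = (x_v)_u` for `x_u = λ₁₁ w₁ + λ₁₂ w₂` and
`x_v = λ₂₁ w₁ + λ₂₂ w₂`, expressed in the frame. On the regular set it is the symmetry of the
Christoffel symbols, and it extends to `U` by density. -/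
theorem closed (h : CompatibleData U E F G e f g EΩ FΩ GΩ eΩ f₁Ω f₂Ω gΩ L aU aV) (hp : p ∈ U)
    (i : Fin 3) :
    (conn (0, 1) EΩ FΩ GΩ aV f₁Ω gΩ p * frameChange L p + matD (0, 1) (frameChange L) p) i 0
      = (conn (1, 0) EΩ FΩ GΩ aU eΩ f₂Ω p * frameChange L p + matD (1, 0) (frameChange L) p) i 1
    := by
  have hT := smoothOn_frameChange h.smooth_L
  have hV := (h.smooth_connV.mul hT).add (hT.matD h.isOpen (0, 1))
  have hU := (h.smooth_connU.mul hT).add (hT.matD h.isOpen (1, 0))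
  refine eqOn_of_eqOn_off (d := fun p => (L p).det) h.isOpen h.interior_eq
    (hV i 0).continuousOn (hU i 1).continuousOn (fun q hq hdet => ?_) p hp
  beta_reduce
  rw [← h.gaugeV hq hdet, ← h.gaugeU hq hdet, Matrix.mul_apply, Matrix.mul_apply]
  refine Finset.sum_congr rfl fun k _ => ?_
  rw [classicalConnU_eq, classicalConnV_eq]
  fin_cases k <;> simp [christoffel_symm]

theorem curvature_eq_zero (h : CompatibleData U E F G e f g EΩ FΩ GΩ eΩ f₁Ω f₂Ω gΩ L aU aV)
    (hE : SmoothOn U E) (hF : SmoothOn U F) (hG : SmoothOn U G) (he : SmoothOn U e)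
    (hf : SmoothOn U f) (hg : SmoothOn U g)
    (hGauss : ∀ p ∈ U, (L p).det ≠ 0 → GaussEq E F G e f g p)
    (hMC : ∀ p ∈ U, (L p).det ≠ 0 → MainardiCodazziEq E F G e f g p) (hp : p ∈ U) :
    curvature (conn (1, 0) EΩ FΩ GΩ aU eΩ f₂Ω) (conn (0, 1) EΩ FΩ GΩ aV f₁Ω gΩ) p = 0 := by
  refine matrix_eqOn_of_eqOn_off (d := fun p => (L p).det) h.isOpen h.interior_eq
    (h.smooth_connU.curvature h.isOpen h.smooth_connV) (matSmoothOn_const 0)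
    (fun q hq hdet => ?_) p hp
  -- the regular set, on which the classical connection is defined
  set S : Set (ℝ × ℝ) := {p ∈ U | (L p).det ≠ 0} with hS
  have hSU : S ⊆ U := fun _ h => h.1
  have hSo : IsOpen S := by
    have hc : ContinuousOn (fun p => (L p).det) U := by
      simp only [Matrix.det_fin_two]
      exact ((h.smooth_L 0 0).continuousOn.mul (h.smooth_L 1 1).continuousOn).sub
        ((h.smooth_L 0 1).continuousOn.mul (h.smooth_L 1 0).continuousOn)
    exact hc.isOpen_inter_preimage h.isOpen isOpen_compl_singleton
  have hD : ∀ p ∈ S, 0 < E p * G p - F p ^ 2 := fun p hp => by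
    have hdet := hp.2
    have := h.pos p hp.1
    rw [h.det_first hp.1]
    positivity
  have hD' : ∀ p ∈ S, E p * G p - F p ^ 2 ≠ 0 := fun p hp => (hD p hp).ne'
  have hqS : q ∈ S := ⟨hq, hdet⟩
  have hE0 : E q ≠ 0 := fun h0 => by
    have := hD q hqS
    rw [h0] at this
    nlinarith [sq_nonneg (F q)]
  have hES : SmoothOn S E := ContDiffOn.mono hE hSU
  have hFS : SmoothOn S F := ContDiffOn.mono hF hSU
  have hGS : SmoothOn S G := ContDiffOn.mono hG hSU
  have heS : SmoothOn S e := ContDiffOn.mono he hSU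
  have hfS : SmoothOn S f := ContDiffOn.mono hf hSU
  have hgS : SmoothOn S g := ContDiffOn.mono hg hSU
  have h0 := curvature_classicalConn_eq_zero hSo hqS hES hFS hGS heS hfS hgS hD' hE0
    (hGauss q hq hdet) (hMC q hq hdet)
  have h1 := mul_curvature_of_gauge hSo (h.smooth_connU.mono hSU) (h.smooth_connV.mono hSU)
    (smoothOn_conn hSo _ hES hFS hGS hD'
      (ContDiffOn.div_const (ContDiffOn.sub (hFS.fderiv_apply hSo _) (hES.fderiv_apply hSo _)) 2)
      heS hfS)
    (smoothOn_conn hSo _ hES hFS hGS hD'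
      (ContDiffOn.div_const (ContDiffOn.sub (hGS.fderiv_apply hSo _) (hFS.fderiv_apply hSo _)) 2)
      hfS hgS)
    ((smoothOn_frameChange h.smooth_L).mono hSU) (fun p hp => h.gaugeU hp.1 hp.2)
    (fun p hp => h.gaugeV hp.1 hp.2) hqS
  have h2 : curvature (classicalConnU E F G e f) (classicalConnV E F G f g) q = 0 := h0
  have hT : IsUnit (frameChange L q) := by
    rw [Matrix.isUnit_iff_isUnit_det, det_frameChange]
    exact hdet.isUnit
  refine hT.mul_right_cancel ?_
  rw [zero_mul, ← h1]
  exact (congrArg (frameChange L q * ·) h2).trans (mul_zero _)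


/-! ### Existence -/

/-- A frame with the prescribed connection, together with a map whose partial derivatives are the
combinations of its first two columns given by `Λ`, realizes the prescribed data. -/
theorem realizes (h : CompatibleData U E F G e f g EΩ FΩ GΩ eΩ f₁Ω f₂Ω gΩ L aU aV)
    (hV : IsOpen V) (hVU : V ⊆ U) {W : ℝ × ℝ → Matrix (Fin 3) (Fin 3) ℝ}
    (hW : IsFrame V EΩ FΩ GΩ aU eΩ f₂Ω aV f₁Ω gΩ W) {x : ℝ × ℝ → Fin 3 → ℝ}
    (hx : VecSmoothOn V x) (hxu : ∀ p ∈ V, ∀ i, vecDu x p i = (W p * frameChange L p) i 0)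
    (hxv : ∀ p ∈ V, ∀ i, vecDv x p i = (W p * frameChange L p) i 1) :
    Realizes V L (symMat EΩ FΩ GΩ) (fun p => !![eΩ p, f₁Ω p; f₂Ω p, gΩ p]) (symMat E F G)
      (symMat e f g) x (frameBase W) := by
  have hxu' : ∀ p ∈ V, ∀ i, vecDu x p i = W p i 0 * L p 0 0 + W p i 1 * L p 0 1 := by
    intro p hp i
    rw [hxu p hp i]
    simp [Matrix.mul_apply, Fin.sum_univ_three, frameChange]
  have hxv' : ∀ p ∈ V, ∀ i, vecDv x p i = W p i 0 * L p 1 0 + W p i 1 * L p 1 1 := by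
    intro p hp i
    rw [hxv p hp i]
    simp [Matrix.mul_apply, Fin.sum_univ_three, frameChange]
  have hn : ∀ p ∈ V, ∀ i, unitNormal (frameBase W) p i = W p i 2 := fun p hp =>
    unitNormal_frameBase (hW.gram p hp) (hW.det_pos p hp)
  have hT : MatSmoothOn V (frameChange L) := (smoothOn_frameChange h.smooth_L).mono hVU
  have hdot : ∀ p ∈ V, ∀ j k, ∑ i, (W p * frameChange L p) i j * (W p * frameChange L p) i k
      = frameMetric E F G p j k := by
    intro p hp j k
    rw [← frameMetric_frameChange (h.first p (hVU hp)), ← hW.gram p hp]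
    have : (frameChange L p)ᵀ * ((W p)ᵀ * W p) * frameChange L p
        = (W p * frameChange L p)ᵀ * (W p * frameChange L p) := by
      rw [Matrix.transpose_mul]; simp only [mul_assoc]
    rw [this, Matrix.mul_apply]
    rfl
  -- the normal components of the second derivatives
  have hnD : ∀ p ∈ V, ∀ j, (∑ i, W p i 2 * matD (1, 0) (fun q => W q * frameChange L q) p i j
        = (connForm (1, 0) EΩ FΩ GΩ aU eΩ f₂Ω p * frameChange L p
          + frameMetric EΩ FΩ GΩ p * matD (1, 0) (frameChange L) p) 2 j) ∧
      ∑ i, W p i 2 * matD (0, 1) (fun q => W q * frameChange L q) p i j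
        = (connForm (0, 1) EΩ FΩ GΩ aV f₁Ω gΩ p * frameChange L p
          + frameMetric EΩ FΩ GΩ p * matD (0, 1) (frameChange L) p) 2 j := by
    intro p hp j
    have hD := (h.pos p (hVU hp)).ne'
    constructor
    · rw [matD_mul hW.smooth hT hV hp, hW.eqU p hp, mul_assoc, ← mul_add, hW.dot_normal hp,
        mul_add, ← mul_assoc, frameMetric_mul_conn _ hD]
    · rw [matD_mul hW.smooth hT hV hp, hW.eqV p hp, mul_assoc, ← mul_add, hW.dot_normal hp,
        mul_add, ← mul_assoc, frameMetric_mul_conn _ hD]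
  have hDT : ∀ ξ p j, matD ξ (frameChange L) p 2 j = 0 := by
    intro ξ p j
    fin_cases j <;> simp [matD, frameChange]
  have hDW : ∀ (ξ : ℝ × ℝ) (y : ℝ × ℝ → Fin 3 → ℝ) (j : Fin 3),
      (∀ p ∈ V, ∀ i, y p i = (W p * frameChange L p) i j) → ∀ p ∈ V, ∀ i,
      fderiv ℝ (fun q => y q i) p ξ = matD ξ (fun q => W q * frameChange L q) p i j := by
    intro ξ y j hy p hp i
    have : (fun q => y q i) =ᶠ[𝓝 p] fun q => (W q * frameChange L q) i j := by
      filter_upwards [hV.mem_nhds hp] with q hq using hy q hq i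
    rw [this.fderiv_eq]
    rfl
  have hcol : ∀ p, (frameBase W p).col = (W p).col ∘ Fin.castSucc := fun p => rfl
  refine ⟨⟨hx, fun p hp => ⟨V, hV, hp, subset_rfl, fun q i => W q i 2, fun i => hW.smooth i 2,
    fun q hq => ?_⟩⟩, ⟨⟨fun i j => hW.smooth i j.castSucc, fun p hp => ?_⟩, fun p hp => ⟨?_, ?_⟩⟩,
    fun p hp => ?_, fun p hp => ?_, fun p hp => ?_, fun p hp => ?_, fun p hp => ?_⟩
  · have hg := hW.gram q hq
    have g20 := congrFun (congrFun hg 2) 0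
    have g21 := congrFun (congrFun hg 2) 1
    have g22 := congrFun (congrFun hg 2) 2
    simp [Matrix.mul_apply, Fin.sum_univ_three, frameMetric] at g20 g21 g22
    simp only [dotProduct, Fin.sum_univ_three, hxu' q hq, hxv' q hq]
    refine ⟨g22, ?_, ?_⟩
    · linear_combination L q 0 0 * g20 + L q 0 1 * g21
    · linear_combination L q 1 0 * g20 + L q 1 1 * g21
  · rw [hcol]
    exact (Matrix.linearIndependent_cols_of_det_ne_zero (hW.det_pos p hp).ne').comp _
      (Fin.castSucc_injective 2)
  · have : vecDu x p = L p 0 0 • (frameBase W p).col 0 + L p 0 1 • (frameBase W p).col 1 := by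
      ext i
      simp [hxu' p hp, frameBase]
      ring
    rw [this]
    exact add_mem (Submodule.smul_mem _ _ (Submodule.subset_span ⟨0, rfl⟩))
      (Submodule.smul_mem _ _ (Submodule.subset_span ⟨1, rfl⟩))
  · have : vecDv x p = L p 1 0 • (frameBase W p).col 0 + L p 1 1 • (frameBase W p).col 1 := by
      ext i
      simp [hxv' p hp, frameBase]
      ring
    rw [this]
    exact add_mem (Submodule.smul_mem _ _ (Submodule.subset_span ⟨0, rfl⟩))
      (Submodule.smul_mem _ _ (Submodule.subset_span ⟨1, rfl⟩))
  · ext i j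
    fin_cases j <;>
      simp [jacobian, hxu' p hp, hxv' p hp, frameBase, Matrix.mul_apply, Fin.sum_univ_two]
  · have hg := hW.gram p hp
    ext i j
    have := congrFun (congrFun hg i.castSucc) j.castSucc
    rw [Matrix.mul_apply] at this
    simp only [baseFirstForm, Matrix.mul_apply]
    refine Eq.trans this ?_
    fin_cases i <;> fin_cases j <;> simp [frameMetric, symMat]
  · exact hW.baseSecondForm_eq hV (fun p hp => (h.pos p (hVU hp)).ne') hp
  · have h00 := hdot p hp 0 0
    have h01 := hdot p hp 0 1
    have h11 := hdot p hp 1 1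
    simp only [← hxu p hp, ← hxv p hp] at h00 h01 h11
    ext i j
    fin_cases i <;> fin_cases j <;> simp [firstForm, symMat, dotProduct]
    · exact h00
    · exact h01
    · exact h01
    · exact h11
  · have hu0 := (hnD p hp 0).1
    have hv0 := (hnD p hp 0).2
    have hv1 := (hnD p hp 1).2
    simp only [← hDW _ _ 0 hxu p hp] at hu0 hv0
    simp only [← hDW _ _ 1 hxv p hp] at hv1
    obtain ⟨⟨he, hf⟩, hf', hg⟩ := h.second_entries (hVU hp)
    simp only [Matrix.add_apply, Matrix.mul_apply, Fin.sum_univ_three, hDT] at hu0 hv0 hv1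
    simp [connForm, frameChange, frameMetric] at hu0 hv0 hv1
    ext i j
    fin_cases i <;> fin_cases j <;>
      simp [secondForm, symMat, dotProduct, Fin.sum_univ_three, hn p hp] <;>
      simp only [vecDu, vecDv, du, dv] at hu0 hv0 hv1 ⊢
    · linarith
    · linarith
    · linarith
    · linarith

/-- Existence of a frontal with the prescribed data near any point. -/
theorem exists_realizes (h : CompatibleData U E F G e f g EΩ FΩ GΩ eΩ f₁Ω f₂Ω gΩ L aU aV)
    (hflat : ∀ p ∈ U,
      curvature (conn (1, 0) EΩ FΩ GΩ aU eΩ f₂Ω) (conn (0, 1) EΩ FΩ GΩ aV f₁Ω gΩ) p = 0)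
    {p₀ : ℝ × ℝ} (hp₀ : p₀ ∈ U) (hE₀ : 0 < EΩ p₀) :
    ∃ V : Set (ℝ × ℝ), IsOpen V ∧ p₀ ∈ V ∧ V ⊆ U ∧
      ∃ (x : ℝ × ℝ → Fin 3 → ℝ) (M : ℝ × ℝ → Matrix (Fin 3) (Fin 2) ℝ),
        Realizes V L (symMat EΩ FΩ GΩ) (fun p => !![eΩ p, f₁Ω p; f₂Ω p, gΩ p]) (symMat E F G)
          (symMat e f g) x M := by
  set r : ℝ := √(EΩ p₀) with hr
  set s : ℝ := √((EΩ p₀ * GΩ p₀ - FΩ p₀ ^ 2) / EΩ p₀) with hs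
  have hr0 : 0 < r := Real.sqrt_pos.2 hE₀
  have hs0 : 0 < s := Real.sqrt_pos.2 (div_pos (h.pos p₀ hp₀) hE₀)
  have hr2 : r ^ 2 = EΩ p₀ := Real.sq_sqrt hE₀.le
  have hs2 : s ^ 2 = (EΩ p₀ * GΩ p₀ - FΩ p₀ ^ 2) / EΩ p₀ :=
    Real.sq_sqrt (div_pos (h.pos p₀ hp₀) hE₀).le
  -- the initial frame is the Cholesky factor of the metric
  set W₀ : Matrix (Fin 3) (Fin 3) ℝ := !![r, FΩ p₀ / r, 0; 0, s, 0; 0, 0, 1] with hW₀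
  have hW₀gram : W₀ᵀ * W₀ = frameMetric EΩ FΩ GΩ p₀ := by
    ext i j
    fin_cases i <;> fin_cases j <;>
      simp [hW₀, Matrix.mul_apply, Fin.sum_univ_three, frameMetric]
    · rw [← hr2]; ring
    · field_simp
    · field_simp
    · have h1 : FΩ p₀ / r * (FΩ p₀ / r) = FΩ p₀ ^ 2 / EΩ p₀ := by rw [← hr2]; field_simp
      rw [h1, ← pow_two, hs2]
      field_simp
      ring
  have hW₀det : 0 < W₀.det := by
    have : W₀.det = r * s := by simp [hW₀, Matrix.det_fin_three]
    rw [this]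
    positivity
  obtain ⟨ε, hε, hsub, W, hWp, hWs, hWu, hWv⟩ :=
    exists_frame_of_curvature_eq_zero h.isOpen h.smooth_connU h.smooth_connV hflat hp₀ W₀
  have hp₀V : p₀ ∈ ball p₀ ε := mem_ball_self hε
  have hconv : Convex ℝ (ball p₀ ε) := convex_ball _ _
  have hpre : IsPreconnected (ball p₀ ε) := hconv.isPreconnected
  have hD : ∀ p ∈ ball p₀ ε, EΩ p * GΩ p - FΩ p ^ 2 ≠ 0 := fun p hp => (h.pos p (hsub hp)).ne'
  have sE : SmoothOn (ball p₀ ε) EΩ := ContDiffOn.mono h.smooth_EΩ hsub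
  have sF : SmoothOn (ball p₀ ε) FΩ := ContDiffOn.mono h.smooth_FΩ hsub
  have sG : SmoothOn (ball p₀ ε) GΩ := ContDiffOn.mono h.smooth_GΩ hsub
  have hgram : ∀ p ∈ ball p₀ ε, (W p)ᵀ * W p = frameMetric EΩ FΩ GΩ p := by
    intro p hp
    refine transpose_mul_self_of_mul_inv (hD p hp) ?_
    have := eq_of_matD_eq_zero ((hWs.mul (smoothOn_frameMetricInv sE sF sG hD)).mul hWs.transpose)
      isOpen_ball hpre
      (fun q hq => matD_mul_inv_mul_transpose isOpen_ball hq _ sE sF sG hD hWs hWs (hWu q hq)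
        (hWu q hq))
      (fun q hq => matD_mul_inv_mul_transpose isOpen_ball hq _ sE sF sG hD hWs hWs (hWv q hq)
        (hWv q hq)) hp hp₀V
    refine Eq.trans this ?_
    rw [hWp]
    exact mul_inv_mul_transpose_eq_one (hD p₀ hp₀V) hW₀gram
  have hdet0 : ∀ p ∈ ball p₀ ε, (W p).det ≠ 0 := by
    intro p hp h0
    have := congrArg Matrix.det (hgram p hp)
    rw [Matrix.det_mul, h0, mul_zero] at this
    refine hD p hp ?_
    simp [frameMetric, Matrix.det_fin_three] at this
    linear_combination -this
  have hdetc : ContinuousOn (fun p => (W p).det) (ball p₀ ε) := by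
    simp only [Matrix.det_fin_three]
    have hc := fun i j => (hWs i j).continuousOn
    fun_prop
  have hdet : ∀ p ∈ ball p₀ ε, 0 < (W p).det := by
    intro p hp
    by_contra hneg
    obtain ⟨q, hq, hq0⟩ := hpre.intermediate_value hp hp₀V hdetc
      (show (0 : ℝ) ∈ Icc (W p).det (W p₀).det from ⟨not_lt.1 hneg, by rw [hWp]; exact hW₀det.le⟩)
    exact hdet0 q hq hq0
  have hframe : IsFrame (ball p₀ ε) EΩ FΩ GΩ aU eΩ f₂Ω aV f₁Ω gΩ W := ⟨hWs, hgram, hdet, hWu, hWv⟩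
  have hT : MatSmoothOn (ball p₀ ε) (frameChange L) :=
    (smoothOn_frameChange h.smooth_L).mono hsub
  have hprim : ∀ i : Fin 3, ∃ y : ℝ × ℝ → ℝ, SmoothOn (ball p₀ ε) y ∧ ∀ p ∈ ball p₀ ε,
      du y p = (W p * frameChange L p) i 0 ∧ dv y p = (W p * frameChange L p) i 1 := by
    intro i
    refine exists_primitive isOpen_ball hconv ((hWs.mul hT) i 0) ((hWs.mul hT) i 1)
      fun p hp => ?_
    have h1 : matD (0, 1) (fun q => W q * frameChange L q) p i 0
        = matD (1, 0) (fun q => W q * frameChange L q) p i 1 := by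
      rw [matD_mul hWs hT isOpen_ball hp, matD_mul hWs hT isOpen_ball hp, hWu p hp, hWv p hp,
        mul_assoc, mul_assoc, ← mul_add, ← mul_add, Matrix.mul_apply, Matrix.mul_apply]
      exact Finset.sum_congr rfl fun k _ => by rw [h.closed (hsub hp) k]
    exact h1
  choose y hys hy using hprim
  exact ⟨ball p₀ ε, isOpen_ball, hp₀V, hsub, fun p i => y i p, frameBase W,
    h.realizes isOpen_ball hsub hframe hys (fun p hp i => (hy i p hp).1)
      (fun p hp i => (hy i p hp).2)⟩

/-! ### Uniqueness -/

/-- The frame of a realization satisfies the frame equations with the prescribed connection. The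
functions `aU` and `aV` of the realization are determined on the regular set by `(x_u)_v = (x_v)_u`,
hence everywhere by density. -/
theorem isFrame_of_realizes (h : CompatibleData U E F G e f g EΩ FΩ GΩ eΩ f₁Ω f₂Ω gΩ L aU aV)
    {x : ℝ × ℝ → Fin 3 → ℝ} {M : ℝ × ℝ → Matrix (Fin 3) (Fin 2) ℝ}
    (hR : Realizes U L (symMat EΩ FΩ GΩ) (fun p => !![eΩ p, f₁Ω p; f₂Ω p, gΩ p]) (symMat E F G)
      (symMat e f g) x M) :
    IsFrame U EΩ FΩ GΩ aU eΩ f₂Ω aV f₁Ω gΩ (baseFrame M) ∧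
      ∀ p ∈ U, ∀ i, vecDu x p i = (baseFrame M p * frameChange L p) i 0 ∧
        vecDv x p i = (baseFrame M p * frameChange L p) i 1 := by
  have hU := h.isOpen
  have hD : ∀ p ∈ U, EΩ p * GΩ p - FΩ p ^ 2 ≠ 0 := fun p hp => (h.pos p hp).ne'
  have hW : MatSmoothOn U (baseFrame M) := baseFrame_smooth hR.tangent.1.1 hR.base_first h.pos
  have hT := smoothOn_frameChange h.smooth_L
  have hgram : ∀ p ∈ U, (baseFrame M p)ᵀ * baseFrame M p = frameMetric EΩ FΩ GΩ p := fun p hp =>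
    baseFrame_gram (hR.base_first p hp) (h.pos p hp)
  have hx : ∀ p ∈ U, ∀ i, vecDu x p i = (baseFrame M p * frameChange L p) i 0 ∧
      vecDv x p i = (baseFrame M p * frameChange L p) i 1 := by
    intro p hp i
    have hd := hR.differential p hp
    have h0 := congrFun (congrFun hd i) 0
    have h1 := congrFun (congrFun hd i) 1
    simp [jacobian, Matrix.mul_apply, Fin.sum_univ_two] at h0 h1
    simp [Matrix.mul_apply, Fin.sum_univ_three, frameChange, baseFrame, h0, h1]
  -- the inner products of the frame with its derivatives
  set N : ℝ × ℝ → ℝ × ℝ → Matrix (Fin 3) (Fin 3) ℝ := fun ξ p =>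
    (baseFrame M p)ᵀ * matD ξ (baseFrame M) p with hN
  have hNs : ∀ ξ, MatSmoothOn U (N ξ) := fun ξ => hW.transpose.mul (hW.matD hU ξ)
  have hNsymm : ∀ ξ, ∀ p ∈ U, N ξ p + (N ξ p)ᵀ = matD ξ (frameMetric EΩ FΩ GΩ) p := by
    intro ξ p hp
    rw [← matD_congr hU hp hgram, matD_mul hW.transpose hW hU hp, matD_transpose, hN]
    simp only [Matrix.transpose_mul, Matrix.transpose_transpose]
    exact add_comm _ _
  have hconnForm : ∀ ξ, ∀ b c : ℝ × ℝ → ℝ, ∀ p ∈ U, N ξ p 0 2 = -b p → N ξ p 1 2 = -c p →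
      N ξ p = connForm ξ EΩ FΩ GΩ (fun p => (N ξ p 1 0 - N ξ p 0 1) / 2) b c p := by
    intro ξ b c p hp hb hc
    have hs := hNsymm ξ p hp
    have entry : ∀ i j, N ξ p i j + N ξ p j i = matD ξ (frameMetric EΩ FΩ GΩ) p i j := fun i j =>
      congrFun (congrFun hs i) j
    have s00 := entry 0 0
    have s01 := entry 0 1
    have s02 := entry 0 2
    have s11 := entry 1 1
    have s12 := entry 1 2
    have s22 := entry 2 2
    simp [matD, frameMetric] at s00 s01 s02 s11 s12 s22
    ext i j
    fin_cases i <;> fin_cases j <;> simp [connForm] <;> linarith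
  have hnormal : ∀ p ∈ U, (N (1, 0) p 0 2 = -eΩ p ∧ N (1, 0) p 1 2 = -f₂Ω p) ∧
      N (0, 1) p 0 2 = -f₁Ω p ∧ N (0, 1) p 1 2 = -gΩ p := by
    intro p hp
    have hs := hR.base_second p hp
    have s00 := congrFun (congrFun hs 0) 0
    have s01 := congrFun (congrFun hs 0) 1
    have s10 := congrFun (congrFun hs 1) 0
    have s11 := congrFun (congrFun hs 1) 1
    simp [baseSecondForm, Matrix.mul_apply, Fin.sum_univ_three, jacobian, vecDu, vecDv, du, dv]
      at s00 s01 s10 s11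
    simp [hN, Matrix.mul_apply, Fin.sum_univ_three, matD, baseFrame]
    refine ⟨⟨?_, ?_⟩, ?_, ?_⟩ <;> linarith
  set a₁ : ℝ × ℝ → ℝ := fun p => (N (1, 0) p 1 0 - N (1, 0) p 0 1) / 2 with ha₁
  set a₂ : ℝ × ℝ → ℝ := fun p => (N (0, 1) p 1 0 - N (0, 1) p 0 1) / 2 with ha₂
  have hNu : ∀ p ∈ U, N (1, 0) p = connForm (1, 0) EΩ FΩ GΩ a₁ eΩ f₂Ω p := fun p hp =>
    hconnForm _ _ _ p hp (hnormal p hp).1.1 (hnormal p hp).1.2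
  have hNv : ∀ p ∈ U, N (0, 1) p = connForm (0, 1) EΩ FΩ GΩ a₂ f₁Ω gΩ p := fun p hp =>
    hconnForm _ _ _ p hp (hnormal p hp).2.1 (hnormal p hp).2.2
  have hmixed : ∀ p ∈ U, ∀ i, matD (0, 1) (fun q => baseFrame M q * frameChange L q) p i 0
      = matD (1, 0) (fun q => baseFrame M q * frameChange L q) p i 1 := by
    intro p hp i
    have h1 : (fun q => fderiv ℝ (fun q => x q i) q (1, 0)) =ᶠ[𝓝 p]
        fun q => (baseFrame M q * frameChange L q) i 0 := by
      filter_upwards [hU.mem_nhds hp] with q hq using (hx q hq i).1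
    have h2 : (fun q => fderiv ℝ (fun q => x q i) q (0, 1)) =ᶠ[𝓝 p]
        fun q => (baseFrame M q * frameChange L q) i 1 := by
      filter_upwards [hU.mem_nhds hp] with q hq using (hx q hq i).2
    have h3 := (hR.frontal.1 i).fderiv_comm hU hp (1, 0) (0, 1)
    rw [h1.fderiv_eq, h2.fderiv_eq] at h3
    exact h3
  have hdet : ∀ p ∈ U, a₁ p * (L p).det = aU p * (L p).det ∧
      a₂ p * (L p).det = aV p * (L p).det := by
    intro p hp
    set k₁ : ℝ × ℝ → ℝ := fun p =>
      a₁ p * (L p).det + twist (1, 0) L (symMat EΩ FΩ GΩ) p / 2 with hk₁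
    set k₂ : ℝ × ℝ → ℝ := fun p =>
      a₂ p * (L p).det + twist (0, 1) L (symMat EΩ FΩ GΩ) p / 2 with hk₂
    have hse := h.second_entries hp
    have hcu : (baseFrame M p * frameChange L p)ᵀ
        * matD (1, 0) (fun q => baseFrame M q * frameChange L q) p
        = connForm (1, 0) E F G k₁ e f p := by
      rw [← connForm_frameChange hU hp _ h.smooth_EΩ h.smooth_FΩ h.smooth_GΩ h.smooth_L h.first
        hse.1.1 hse.1.2 rfl, matD_mul hW hT hU hp, Matrix.transpose_mul, ← hNu p hp,
        ← hgram p hp, hN]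
      simp only [mul_add, mul_assoc]
    have hcv : (baseFrame M p * frameChange L p)ᵀ
        * matD (0, 1) (fun q => baseFrame M q * frameChange L q) p
        = connForm (0, 1) E F G k₂ f g p := by
      rw [← connForm_frameChange hU hp _ h.smooth_EΩ h.smooth_FΩ h.smooth_GΩ h.smooth_L h.first
        hse.2.1 hse.2.2 rfl, matD_mul hW hT hU hp, Matrix.transpose_mul, ← hNv p hp,
        ← hgram p hp, hN]
      simp only [mul_add, mul_assoc]
    have hsame : ∀ i, connForm (0, 1) E F G k₂ f g p i 0 = connForm (1, 0) E F G k₁ e f p i 1 := by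
      intro i
      rw [← hcu, ← hcv, Matrix.mul_apply, Matrix.mul_apply]
      exact Finset.sum_congr rfl fun j _ => by rw [hmixed p hp j]
    have e0 := hsame 0
    have e1 := hsame 1
    simp [connForm, hk₁, hk₂] at e0 e1
    have t1 := h.twistU p hp
    have t2 := h.twistV p hp
    simp only [du, dv] at t1 t2
    constructor <;> linarith
  have hNds : ∀ ξ, ContinuousOn (fun p => (N ξ p 1 0 - N ξ p 0 1) / 2) U := fun ξ =>
    (((hNs ξ) 1 0).continuousOn.sub ((hNs ξ) 0 1).continuousOn).div_const 2
  have ha : ∀ p ∈ U, a₁ p = aU p :=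
    eqOn_of_eqOn_off hU h.interior_eq (hNds _) h.smooth_aU.continuousOn
      fun p hp hne => mul_right_cancel₀ hne (hdet p hp).1
  have ha' : ∀ p ∈ U, a₂ p = aV p :=
    eqOn_of_eqOn_off hU h.interior_eq (hNds _) h.smooth_aV.continuousOn
      fun p hp hne => mul_right_cancel₀ hne (hdet p hp).2
  have hback : ∀ ξ, ∀ p ∈ U, baseFrame M p * (frameMetricInv EΩ FΩ GΩ p * N ξ p)
      = matD ξ (baseFrame M) p := by
    intro ξ p hp
    rw [hN, ← mul_assoc, ← mul_assoc, mul_inv_mul_transpose_eq_one (hD p hp) (hgram p hp), one_mul]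
  refine ⟨⟨hW, hgram, fun p hp => baseFrame_det_pos (hR.base_first p hp) (h.pos p hp),
    fun p hp => ?_, fun p hp => ?_⟩, hx⟩
  · rw [← hback _ p hp, hNu p hp, conn]
    simp only [connForm, ha p hp]
  · rw [← hback _ p hp, hNv p hp, conn]
    simp only [connForm, ha' p hp]

/-- Two realizations on a connected set differ by a rigid motion. -/
theorem exists_rigid_motion (h : CompatibleData U E F G e f g EΩ FΩ GΩ eΩ f₁Ω f₂Ω gΩ L aU aV)
    (hc : IsConnected U) {x x' : ℝ × ℝ → Fin 3 → ℝ} {M M' : ℝ × ℝ → Matrix (Fin 3) (Fin 2) ℝ}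
    (hR : Realizes U L (symMat EΩ FΩ GΩ) (fun p => !![eΩ p, f₁Ω p; f₂Ω p, gΩ p]) (symMat E F G)
      (symMat e f g) x M)
    (hR' : Realizes U L (symMat EΩ FΩ GΩ) (fun p => !![eΩ p, f₁Ω p; f₂Ω p, gΩ p]) (symMat E F G)
      (symMat e f g) x' M') :
    ∃ ρ ∈ Matrix.specialOrthogonalGroup (Fin 3) ℝ, ∃ a : Fin 3 → ℝ,
      ∀ p ∈ U, M' p = ρ * M p ∧ x' p = ρ *ᵥ x p + a := by
  obtain ⟨hW, hx⟩ := h.isFrame_of_realizes hR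
  obtain ⟨hW', hx'⟩ := h.isFrame_of_realizes hR'
  have hU := h.isOpen
  have hD : ∀ p ∈ U, EΩ p * GΩ p - FΩ p ^ 2 ≠ 0 := fun p hp => (h.pos p hp).ne'
  have sK := smoothOn_frameMetricInv h.smooth_EΩ h.smooth_FΩ h.smooth_GΩ hD
  obtain ⟨p₀, hp₀⟩ := hc.nonempty
  set ρ : Matrix (Fin 3) (Fin 3) ℝ :=
    baseFrame M' p₀ * frameMetricInv EΩ FΩ GΩ p₀ * (baseFrame M p₀)ᵀ with hρ
  have hconst : ∀ p ∈ U,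
      baseFrame M' p * frameMetricInv EΩ FΩ GΩ p * (baseFrame M p)ᵀ = ρ := fun p hp =>
    eq_of_matD_eq_zero ((hW'.smooth.mul sK).mul hW.smooth.transpose) hU hc.isPreconnected
      (fun q hq => matD_mul_inv_mul_transpose hU hq _ h.smooth_EΩ h.smooth_FΩ h.smooth_GΩ hD
        hW.smooth hW'.smooth (hW.eqU q hq) (hW'.eqU q hq))
      (fun q hq => matD_mul_inv_mul_transpose hU hq _ h.smooth_EΩ h.smooth_FΩ h.smooth_GΩ hD
        hW.smooth hW'.smooth (hW.eqV q hq) (hW'.eqV q hq)) hp hp₀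
  have hrot : ∀ p ∈ U, baseFrame M' p = ρ * baseFrame M p := by
    intro p hp
    rw [← hconst p hp, mul_assoc, hW.gram p hp, mul_assoc, frameMetricInv_mul (hD p hp), mul_one]
  have horth : ρ * ρᵀ = 1 := by
    calc ρ * ρᵀ = baseFrame M' p₀ * (frameMetricInv EΩ FΩ GΩ p₀
          * ((baseFrame M p₀)ᵀ * baseFrame M p₀)) * frameMetricInv EΩ FΩ GΩ p₀
          * (baseFrame M' p₀)ᵀ := by
          rw [hρ]
          simp only [Matrix.transpose_mul, Matrix.transpose_transpose, frameMetricInv_transpose,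
            mul_assoc]
      _ = 1 := by
          rw [hW.gram p₀ hp₀, frameMetricInv_mul (hD p₀ hp₀), mul_one]
          exact mul_inv_mul_transpose_eq_one (hD p₀ hp₀) (hW'.gram p₀ hp₀)
  have hdet : ρ.det = 1 := by
    have h1 : ρ.det * ρ.det = 1 := by
      have := congrArg Matrix.det horth
      rwa [Matrix.det_mul, Matrix.det_transpose, Matrix.det_one] at this
    have h2 : 0 < ρ.det * (baseFrame M p₀).det := by
      rw [← Matrix.det_mul, ← hrot p₀ hp₀]
      exact hW'.det_pos p₀ hp₀
    have h3 : 0 < ρ.det := (mul_pos_iff_of_pos_right (hW.det_pos p₀ hp₀)).1 h2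
    nlinarith
  have hxdiff : ∀ p ∈ U, ∀ i, x' p i - ∑ j, ρ i j * x p j = x' p₀ i - ∑ j, ρ i j * x p₀ j := by
    intro p hp i
    have hd : ∀ q ∈ U, HasFDerivAt (fun q => x' q i - ∑ j, ρ i j * x q j)
        (fderiv ℝ (fun q => x' q i) q - ∑ j, ρ i j • fderiv ℝ (fun q => x q j) q) q :=
      fun q hq => (((hR'.frontal.1 i).differentiableAt hU hq).hasFDerivAt).sub
        (HasFDerivAt.fun_sum fun j _ =>
          ((hR.frontal.1 j).differentiableAt hU hq).hasFDerivAt.const_mul (ρ i j))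
    have hzero : ∀ q ∈ U, ∀ (ξ : ℝ × ℝ) (k : Fin 3),
        (∀ i, fderiv ℝ (fun q => x q i) q ξ = (baseFrame M q * frameChange L q) i k) →
        (∀ i, fderiv ℝ (fun q => x' q i) q ξ = (baseFrame M' q * frameChange L q) i k) →
        fderiv ℝ (fun q => x' q i - ∑ j, ρ i j * x q j) q ξ = 0 := by
      intro q hq ξ k hk hk'
      rw [(hd q hq).fderiv, sub_apply, sum_apply, hk', hrot q hq, mul_assoc, Matrix.mul_apply,
        sub_eq_zero]
      exact Finset.sum_congr rfl fun j _ => by rw [smul_apply, hk, smul_eq_mul]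
    exact eq_of_partials_eq_zero (f := fun q => x' q i - ∑ j, ρ i j * x q j) hU hc.isPreconnected
      (fun q hq => (hd q hq).differentiableAt)
      (fun q hq => hzero q hq _ 0 (fun i => (hx q hq i).1) fun i => (hx' q hq i).1)
      (fun q hq => hzero q hq _ 1 (fun i => (hx q hq i).2) fun i => (hx' q hq i).2) hp hp₀
  refine ⟨ρ, ?_, fun i => x' p₀ i - ∑ j, ρ i j * x p₀ j, fun p hp => ⟨?_, ?_⟩⟩
  · rw [Matrix.mem_specialOrthogonalGroup_iff, Matrix.mem_orthogonalGroup_iff]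
    exact ⟨horth, hdet⟩
  · ext i j
    have h1 := congrFun (congrFun (hrot p hp) i) j.castSucc
    rw [Matrix.mul_apply] at h1 ⊢
    fin_cases j
    · exact h1
    · exact h1
  · ext i
    rw [Pi.add_apply, ← hxdiff p hp i]
    simp only [Matrix.mulVec, dotProduct]
    ring

end CompatibleData

end Frontals

end

theorem theorem5p1
    (U : Set (ℝ × ℝ)) (hU : IsOpen U)
    (E F G e f g : ℝ × ℝ → ℝ)
    (EΩ FΩ GΩ eΩ f₁Ω f₂Ω gΩ : ℝ × ℝ → ℝ)
    (Λ : ℝ × ℝ → Matrix (Fin 2) (Fin 2) ℝ)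
    (hE : Frontals.SmoothOn U E) (hF : Frontals.SmoothOn U F) (hG : Frontals.SmoothOn U G)
    (he : Frontals.SmoothOn U e) (hf : Frontals.SmoothOn U f) (hg : Frontals.SmoothOn U g)
    (hEΩ : Frontals.SmoothOn U EΩ) (hFΩ : Frontals.SmoothOn U FΩ) (hGΩ : Frontals.SmoothOn U GΩ)
    (heΩ : Frontals.SmoothOn U eΩ) (hf₁Ω : Frontals.SmoothOn U f₁Ω)
    (hf₂Ω : Frontals.SmoothOn U f₂Ω) (hgΩ : Frontals.SmoothOn U gΩ)
    (hΛ : Frontals.MatSmoothOn U Λ)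
    (hI_nonneg : ∀ p ∈ U, 0 ≤ E p ∧ 0 ≤ G p ∧ 0 ≤ E p * G p - F p ^ 2)
    (hI : ∀ p ∈ U,
      Frontals.symMat E F G p = Λ p * Frontals.symMat EΩ FΩ GΩ p * (Λ p)ᵀ)
    (hII : ∀ p ∈ U,
      Frontals.symMat e f g p = Λ p * !![eΩ p, f₁Ω p; f₂Ω p, gΩ p])
    (hIΩ_pos : ∀ p ∈ U, 0 < EΩ p ∧ 0 < GΩ p ∧ 0 < EΩ p * GΩ p - FΩ p ^ 2)
    (hsing : interior {p ∈ U | (Λ p).det = 0} = ∅)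
    (hideal₁ : Frontals.MemPrincipalIdeal U (fun p => (Λ p).det) fun p =>
      Frontals.matDu Λ p 0 ⬝ᵥ (Frontals.symMat EΩ FΩ GΩ p *ᵥ Λ p 1)
        - Λ p 0 ⬝ᵥ (Frontals.symMat EΩ FΩ GΩ p *ᵥ Frontals.matDu Λ p 1)
        + Frontals.dv E p - Frontals.du F p)
    (hideal₂ : Frontals.MemPrincipalIdeal U (fun p => (Λ p).det) fun p =>
      Frontals.matDv Λ p 0 ⬝ᵥ (Frontals.symMat EΩ FΩ GΩ p *ᵥ Λ p 1)
        - Λ p 0 ⬝ᵥ (Frontals.symMat EΩ FΩ GΩ p *ᵥ Frontals.matDv Λ p 1)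
        + Frontals.dv F p - Frontals.du G p)
    (hGauss : ∀ p ∈ U, (Λ p).det ≠ 0 → Frontals.GaussEq E F G e f g p)
    (hMC : ∀ p ∈ U, (Λ p).det ≠ 0 → Frontals.MainardiCodazziEq E F G e f g p) :
    (∀ p₀ ∈ U, ∃ V : Set (ℝ × ℝ), IsOpen V ∧ p₀ ∈ V ∧ V ⊆ U ∧
      ∃ (x : ℝ × ℝ → Fin 3 → ℝ) (Ω : ℝ × ℝ → Matrix (Fin 3) (Fin 2) ℝ),
        Frontals.Realizes V Λ (Frontals.symMat EΩ FΩ GΩ)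
          (fun p => !![eΩ p, f₁Ω p; f₂Ω p, gΩ p])
          (Frontals.symMat E F G) (Frontals.symMat e f g) x Ω) ∧
    (IsConnected U →
      ∀ (x x' : ℝ × ℝ → Fin 3 → ℝ) (Ω Ω' : ℝ × ℝ → Matrix (Fin 3) (Fin 2) ℝ),
        Frontals.Realizes U Λ (Frontals.symMat EΩ FΩ GΩ)
          (fun p => !![eΩ p, f₁Ω p; f₂Ω p, gΩ p])
          (Frontals.symMat E F G) (Frontals.symMat e f g) x Ω →
        Frontals.Realizes U Λ (Frontals.symMat EΩ FΩ GΩ)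
          (fun p => !![eΩ p, f₁Ω p; f₂Ω p, gΩ p])
          (Frontals.symMat E F G) (Frontals.symMat e f g) x' Ω' →
        ∃ ρ ∈ Matrix.specialOrthogonalGroup (Fin 3) ℝ, ∃ a : Fin 3 → ℝ,
          ∀ p ∈ U, Ω' p = ρ * Ω p ∧ x' p = ρ *ᵥ x p + a) := by
  obtain ⟨t₁, ht₁, h₁⟩ := hideal₁
  obtain ⟨t₂, ht₂, h₂⟩ := hideal₂
  have h : Frontals.CompatibleData U E F G e f g EΩ FΩ GΩ eΩ f₁Ω f₂Ω gΩ Λ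
      (fun p => -t₁ p / 2) (fun p => -t₂ p / 2) :=
    { isOpen := hU
      smooth_EΩ := hEΩ
      smooth_FΩ := hFΩ
      smooth_GΩ := hGΩ
      smooth_eΩ := heΩ
      smooth_f₁Ω := hf₁Ω
      smooth_f₂Ω := hf₂Ω
      smooth_gΩ := hgΩ
      smooth_L := hΛ
      smooth_aU := ContDiffOn.div_const (ContDiffOn.neg ht₁) 2
      smooth_aV := ContDiffOn.div_const (ContDiffOn.neg ht₂) 2
      pos := fun p hp => (hIΩ_pos p hp).2.2
      first := hI
      second := hII
      interior_eq := hsing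
      twistU := fun p hp => by
        have h3 : Frontals.twist (1, 0) Λ (Frontals.symMat EΩ FΩ GΩ) p + Frontals.dv E p
          - Frontals.du F p = (Λ p).det * t₁ p := h₁ p hp
        linear_combination h3 / 2
      twistV := fun p hp => by
        have h3 : Frontals.twist (0, 1) Λ (Frontals.symMat EΩ FΩ GΩ) p + Frontals.dv F p
          - Frontals.du G p = (Λ p).det * t₂ p := h₂ p hp
        linear_combination h3 / 2 }
  exact ⟨fun p₀ hp₀ => h.exists_realizes
      (fun p hp => h.curvature_eq_zero hE hF hG he hf hg hGauss hMC hp) hp₀ (hIΩ_pos p₀ hp₀).1,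
    fun hc x x' Ω Ω' hR hR' => h.exists_rigid_motion hc hR hR'⟩
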